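/- Let $n\ge 1$. An $\alpha/\beta$-staircase tableau of size $n$ is a filling of the Young diagram of shape $(n,n-1,\dots,1)$ in which each box is empty or contains $\alpha$ or $\beta$, such that every box $(i,j)$ with $i+j=n+1$ is non-empty, all boxes above an $\alpha$ in its column are empty, and all boxes to the left of a $\beta$ in its row are empty. For $\alpha,\beta\in[0,\infty)$, $(\alpha,\beta)\ne(0,0)$, let $\mathbb P_{n}=\mathbb P_{n,\alpha,\beta}$ be the probability measure that gives each such tableau a probability proportional to its weight $\alpha^{\#\alpha}\beta^{\#\beta}$; the values $\alpha=\infty$ and $\beta=\infty$ are allowed through the limits $\alpha\to\infty$ ($\beta$ fixed), $\beta\to\infty$ ($\alpha$ fixed) and $\alpha=\beta\to\infty$, provided the fixed weight is positive. Put $a=\alpha^{-1}$, $b=\beta^{-1}$ (with $\infty^{-1}=0$ and $0^{-1}=\infty$) and $(y)_2=y(y-1)$. For $x\in\{\alpha,\beta\}$, let $x_j$ be the event that the box $(n-k-j+2,\,j)$, which is the box of the $k$-th diagonal in column $j$, contains the symbol $x$. **Theorem.** Let $k\ge 2$ and $r_1,r_2\ge 0$, and write $r=r_1+r_2$. There is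 a constant $C$ depending only on $k,r_1,r_2$ such that the following holds for all $n\ge1$, all $a,b\in[0,\infty)$, all integers $1\le j_1<\dots<j_r\le n-k+1$, and all assignments $x_{j_1},\dots,x_{j_r}$ of $r_1$ symbols $\alpha$, at positions $j^a_1<\dots<j^a_{r_1}$, and $r_2$ symbols $\beta$, at positions $j^b_1<\dots<j^b_{r_2}$. (i) If $j_{l+1}-j_l\ge k$ for all $l=1,\dots,r-1$, then $$\mathbb P_n(x_{j_1},\dots,x_{j_r})=\prod_{l=1}^{r_1}\mathbb P_n(\alpha_{j^a_l})\prod_{l=1}^{r_2}\mathbb P_n(\beta_{j^b_l})+E,$$ $$\mathbb P_n(x_{j_1},\dots,x_{j_r})=\prod_{l=1}^{r_1}\frac{b+j^a_l-1}{(n+a+b-k+1)_2}\prod_{l=1}^{r_2}\frac{n-j^b_l-k+a+1}{(n+a+b-k+1)_2}+E',$$ with $|E|,|E'|\le C\,(n+a+b)^{-r-1}$. (A factor with zero denominator, which occurs only if $n=k$ and $a=b=0$, is read as $0$.) (ii) Otherwise, $\mathbb P_n(x_{j_1},\dots,x_{j_r})\le C\,(n+a+b)^{-r}$. In the remaining cases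 $\alpha=0<\beta<\infty$ and $\beta=0<\alpha<\infty$ (where $n+a+b=\infty$), $\mathbb P_n(x_{j_1},\dots,x_{j_r})=0$ whenever $r\ge1$. -/

import Mathlib

open Filter Topology

/-- The symbols of an `α/β`-staircase tableau. -/
inductive ABSymbol : Type
  | alpha : ABSymbol
  | beta : ABSymbol
  deriving DecidableEq

instance : Fintype ABSymbol :=
  ⟨{ABSymbol.alpha, ABSymbol.beta}, by rintro (_ | _) <;> simp⟩

/-- `T` is an `α/β`-staircase tableau of size `n`. Rows are numbered from the top and columns from
the left; the paper's box `(i + 1, j + 1)` is the pair `(i, j)` here, so the shape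
`n, n - 1, …, 1` consists of the boxes with `i + j < n` and the first diagonal of those with
`i + j + 1 = n`. `none` means an empty box (or a position outside the shape). -/
structure IsStaircaseTableau {n : ℕ} (T : Fin n → Fin n → Option ABSymbol) : Prop where
  /-- There is nothing outside the Young diagram. -/
  outside : ∀ i j : Fin n, n ≤ (i : ℕ) + j → T i j = none
  /-- Each box on the first diagonal contains a symbol. -/
  diagonal : ∀ i j : Fin n, (i : ℕ) + j + 1 = n → T i j ≠ none
  /-- Boxes in the same column and north of an `α` are empty. -/
  north : ∀ i j : Fin n, T i j = some ABSymbol.alpha → ∀ i' : Fin n, i' < i → T i' j = none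
  /-- Boxes in the same row and west of a `β` are empty. -/
  west : ∀ i j : Fin n, T i j = some ABSymbol.beta → ∀ j' : Fin n, j' < j → T i j' = none

/-- The set `S_n` of `α/β`-staircase tableaux of size `n`. -/
def StaircaseTableau (n : ℕ) : Type :=
  {T : Fin n → Fin n → Option ABSymbol // IsStaircaseTableau T}

namespace StaircaseTableau

noncomputable instance (n : ℕ) : Fintype (StaircaseTableau n) := by
  classical
  exact inferInstanceAs
    (Fintype {T : Fin n → Fin n → Option ABSymbol // IsStaircaseTableau T})

/-- The number of boxes of `S` that contain the symbol `x`. -/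
def count {n : ℕ} (S : StaircaseTableau n) (x : ABSymbol) : ℕ :=
  (Finset.univ.filter fun q : Fin n × Fin n => S.1 q.1 q.2 = some x).card

/-- The weight of a tableau: the product of all its symbols. -/
def wt {n : ℕ} (α β : ℝ) (S : StaircaseTableau n) : ℝ :=
  α ^ S.count ABSymbol.alpha * β ^ S.count ABSymbol.beta

/-- The weight generating function `Z_n(α, β)`. -/
noncomputable def partitionFunction (n : ℕ) (α β : ℝ) : ℝ :=
  ∑ S : StaircaseTableau n, wt α β S

open Classical in
/-- The probability `ℙ_{n,α,β}(E)` of a set `E` of tableaux, for finite `α, β`, when `S` has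
probability `wt(S) / Z_n(α, β)`. -/
noncomputable def prob (n : ℕ) (α β : ℝ) (E : Set (StaircaseTableau n)) : ℝ :=
  ∑ S ∈ Finset.univ.filter (fun S : StaircaseTableau n => S ∈ E),
    wt α β S / partitionFunction n α β

/-- `p` is the probability of `E` for the parameters `a = α⁻¹` and `b = β⁻¹` in `[0, ∞)`. If `a` and
`b` are positive this is `ℙ_{n,α,β}(E)`. The values `a = 0` and `b = 0` stand for `α = ∞`, `β = ∞`,
where the probability is the limit as `α → ∞` with `β` fixed, as `β → ∞` with `α` fixed, or as
`α = β → ∞`. -/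
def IsProb (n : ℕ) (a b : ℝ) (E : Set (StaircaseTableau n)) (p : ℝ) : Prop :=
  (0 < a ∧ 0 < b ∧ p = prob n a⁻¹ b⁻¹ E) ∨
  (a = 0 ∧ 0 < b ∧ Tendsto (fun α : ℝ => prob n α b⁻¹ E) atTop (𝓝 p)) ∨
  (0 < a ∧ b = 0 ∧ Tendsto (fun β : ℝ => prob n a⁻¹ β E) atTop (𝓝 p)) ∨
  (a = 0 ∧ b = 0 ∧ Tendsto (fun t : ℝ => prob n t t E) atTop (𝓝 p))

/-- The event `x_j^k`: there is a symbol `x` in the box of the `k`-th diagonal that lies in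
column `j` (columns counted from `1`), that is in the box `(n - k - j + 2, j)`. -/
def symbolAt (n k : ℕ) (x : ABSymbol) (j : ℕ) : Set (StaircaseTableau n) :=
  {S | ∃ i c : Fin n, (c : ℕ) + 1 = j ∧ ((i : ℕ) + 1) + j + k = n + 2 ∧ S.1 i c = some x}

end StaircaseTableau

/-! After division by `α ^ n * β ^ n`, a tableau weighs `a` per column without `α` and `b` per row
without `β`. Columns are relabelled from the right, so that column `c` ends in row `c`, and rows are
read from the bottom up while remembering the set `Q` of columns further left that carry no `α`
below. A row either has `β` in its corner and nothing else, or it has `α` in the corner, further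
`α`s in some `A ⊆ Q`, and at most one `β`, to the left of all of `A`. Iterating this is `transfer`;
`sum_isPartial` and `scaledSum_matchSet` identify it with the weighted count of tableaux containing
the prescribed symbols.

The engine is `transfer_insert`. Over `m` rows without `β`, of weight `b ^ m`, a new leftmost column
without prescribed symbols contributes `a (b+1)^m` if it has no `α`. Summed over the position of its
`α` it contributes `b ((b+1)^m - b^m)`. The total is `(a+b)(b+1)^m - b * b^m`. Thus a column on the
left can be traded for `b + 1` in place of `b`. This gives the partition function `∏ (a + b + i)`,
reduces every event to the case where its leftmost symbol lies in the leftmost column (with `n + b`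
unchanged), and yields the exact law of one symbol in `transfer_single`.

For several symbols the induction is on their number, removing the one in the lowest row `i`, which
is the one in the leftmost column `i + d`, `d = k - 1`. A row with a prescribed symbol gains a
factor `1 / (n + a + b)`, and the at most `d` rows below it down to row `i + d` lose only constants
(`abs_le_of_rowSum`). This gives the upper bound `transfer_mul_pow_le`. If the symbols are
separated, all others lie in rows and columns before `i`, so the filling above row `i` is compared
with a constant multiple `μ` of the unrestricted one. The resulting difference satisfies the same
linear recursion and gains the same factor (`abs_transfer_sub_mainTerm_le`), while `μ` times the
exact one-symbol probability is the new main term.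

Infinite weights follow by passing to the limit along one path common to all events (`exists_path`).
-/

namespace StaircaseTableau

/-! ### The transfer recursion over rows and rising factorials -/

/-- The number of elements of `Q` that lie strictly to the left of (are larger than) all of `A`. -/
def leftCount (Q A : Finset ℕ) : ℕ := (Q.filter fun c => ∀ x ∈ A, x < c).card

theorem leftCount_insert {Q A : Finset ℕ} {c : ℕ} (hQ : ∀ x ∈ Q, x < c) (hA : A ⊆ Q) :
    leftCount (insert c Q) A = leftCount Q A + 1 := by
  unfold leftCount
  rw [Finset.filter_insert, if_pos fun x hx => hQ x (hA hx), Finset.card_insert_of_notMem]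
  intro h
  exact lt_irrefl _ (hQ c (Finset.mem_filter.1 h).1)

theorem leftCount_insert_insert {Q A : Finset ℕ} {c : ℕ} (hQ : ∀ x ∈ Q, x < c) :
    leftCount (insert c Q) (insert c A) = 0 := by
  unfold leftCount
  rw [Finset.card_eq_zero, Finset.filter_eq_empty_iff]
  intro y hy h
  have h1 := h c (Finset.mem_insert_self _ _)
  rcases Finset.mem_insert.1 hy with rfl | hy
  · exact lt_irrefl _ h1
  · exact lt_asymm h1 (hQ y hy)

theorem leftCount_le_card_sdiff (Q A : Finset ℕ) : leftCount Q A ≤ (Q \ A).card := by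
  refine Finset.card_le_card fun c hc => ?_
  rw [Finset.mem_filter] at hc
  exact Finset.mem_sdiff.2 ⟨hc.1, fun h => lt_irrefl _ (hc.2 c h)⟩

/-- One row of the transfer recursion. The columns are labelled by the index of their lowest row,
`Q` is the set of the free columns left of column `R` in row `R`, and `G` is applied to the set of
the columns that are free above row `R`. If `o = some x`, only rows with an `x` in column `R + d`
are counted. A row without `β` has weight `b`. -/
noncomputable def rowSum (d : ℕ) (b : ℝ) (R : ℕ) (o : Option ABSymbol) (G : Finset ℕ → ℝ)
    (Q : Finset ℕ) : ℝ :=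
  match o with
  | none => G (insert R Q) + ∑ A ∈ Q.powerset, (b + leftCount Q A) * G (Q \ A)
  | some ABSymbol.alpha =>
      ∑ A ∈ Q.powerset, if R + d ∈ A then (b + leftCount Q A) * G (Q \ A) else 0
  | some ABSymbol.beta =>
      if R + d ∈ Q then ∑ A ∈ (Q.filter (· < R + d)).powerset, G (Q \ A) else 0

/-- The weighted number of fillings of the top `R` rows, with the additional free columns `Q`,
that contain the symbols prescribed by `e`. -/
noncomputable def transfer (d : ℕ) (e : ℕ → Option ABSymbol) (a b : ℝ) : ℕ → Finset ℕ → ℝ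
  | 0, Q => a ^ Q.card
  | R + 1, Q => rowSum d b R (e R) (transfer d e a b R) Q

theorem transfer_succ (d : ℕ) (e : ℕ → Option ABSymbol) (a b : ℝ) (R : ℕ) (Q : Finset ℕ) :
    transfer d e a b (R + 1) Q = rowSum d b R (e R) (transfer d e a b R) Q := rfl

/-- The rising factorial `(a + b)(a + b + 1)⋯(a + b + m - 1)`. -/
noncomputable def risingProd (a b : ℝ) (m : ℕ) : ℝ := ∏ i ∈ Finset.range m, (a + b + i)

theorem risingProd_zero (a b : ℝ) : risingProd a b 0 = 1 := by simp [risingProd]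

theorem risingProd_succ (a b : ℝ) (m : ℕ) :
    risingProd a b (m + 1) = risingProd a b m * (a + b + m) := by
  simp [risingProd, Finset.prod_range_succ]

theorem risingProd_succ' (a b : ℝ) (m : ℕ) :
    risingProd a b (m + 1) = (a + b) * risingProd a (b + 1) m := by
  rw [risingProd, Finset.prod_range_succ', mul_comm]
  simp only [risingProd, Nat.cast_zero, add_zero]
  congr 1
  refine Finset.prod_congr rfl fun i _ => ?_
  push_cast
  ring

theorem risingProd_nonneg {a b : ℝ} (h : 0 ≤ a + b) (m : ℕ) : 0 ≤ risingProd a b m :=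
  Finset.prod_nonneg fun i _ => by positivity

theorem risingProd_pos {a b : ℝ} (h : 0 < a + b) (m : ℕ) : 0 < risingProd a b m :=
  Finset.prod_pos fun i _ => by positivity

/-- Every factor except the first is at least `1`; the first, `a + b`, may be small, which is why `1
≤ m` is needed. -/
theorem risingProd_mono {a b : ℝ} (h : 0 ≤ a + b) {m m' : ℕ} (hm : 1 ≤ m) (hmm : m ≤ m') :
    risingProd a b m ≤ risingProd a b m' := by
  induction m', hmm using Nat.le_induction with
  | base => exact le_rfl
  | succ l hl ih =>
    rw [risingProd_succ]
    refine ih.trans (le_mul_of_one_le_right (risingProd_nonneg h l) ?_)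
    have : (1 : ℝ) ≤ l := by exact_mod_cast hm.trans hl
    linarith

theorem rowSum_nonneg {d : ℕ} {b : ℝ} (hb : 0 ≤ b) {R : ℕ} {o : Option ABSymbol}
    {G : Finset ℕ → ℝ} (hG : ∀ Q, 0 ≤ G Q) (Q : Finset ℕ) : 0 ≤ rowSum d b R o G Q := by
  have h : ∀ A, 0 ≤ (b + leftCount Q A) * G (Q \ A) := fun A =>
    mul_nonneg (by positivity) (hG _)
  rcases o with _ | _ | _
  · exact add_nonneg (hG _) (Finset.sum_nonneg fun A _ => h A)
  · exact Finset.sum_nonneg fun A _ => by split_ifs <;> simp [h]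
  · simp only [rowSum]
    split_ifs
    exacts [Finset.sum_nonneg fun A _ => hG _, le_rfl]

theorem transfer_nonneg {d : ℕ} {e : ℕ → Option ABSymbol} {a b : ℝ} (ha : 0 ≤ a) (hb : 0 ≤ b)
    (R : ℕ) (Q : Finset ℕ) : 0 ≤ transfer d e a b R Q := by
  induction R generalizing Q with
  | zero => exact pow_nonneg ha _
  | succ R ih => exact rowSum_nonneg hb ih Q

/-! ### Trading a leftmost column for an increase of `b` -/

/-- Summation over the fillings of an additional column on the left. -/
theorem transfer_insert {d : ℕ} {e : ℕ → Option ABSymbol} {a b : ℝ} {R : ℕ} {Q : Finset ℕ} {c : ℕ}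
    (hQ : ∀ x ∈ Q, x < c) (hR : R ≤ c) (he : ∀ i < R, e i ≠ none → i + d ≠ c) :
    transfer d e a b R (insert c Q) =
      (a + b) * transfer d e a (b + 1) R Q - b * transfer d e a b R Q := by
  induction R generalizing Q with
  | zero =>
    have hc : c ∉ Q := fun h => lt_irrefl _ (hQ c h)
    simp only [transfer, Finset.card_insert_of_notMem hc]
    ring
  | succ R ih =>
    have hc : c ∉ Q := fun h => lt_irrefl _ (hQ c h)
    have ih' : ∀ Q : Finset ℕ, (∀ x ∈ Q, x < c) → transfer d e a b R (insert c Q) =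
        (a + b) * transfer d e a (b + 1) R Q - b * transfer d e a b R Q := fun Q hQ =>
      ih hQ (by omega) fun i hi => he i (by omega)
    have hsub : ∀ A, ∀ x ∈ Q \ A, x < c := fun A x hx => hQ x (Finset.mem_sdiff.1 hx).1
    have h1 : ∀ A ∈ Q.powerset, insert c Q \ A = insert c (Q \ A) := fun A hA =>
      Finset.insert_sdiff_of_notMem _ fun h => hc (Finset.mem_powerset.1 hA h)
    have h2 : ∀ A : Finset ℕ, insert c Q \ insert c A = Q \ A := fun A => by
      rw [Finset.insert_sdiff_insert, Finset.sdiff_insert, Finset.erase_eq_of_notMem]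
      exact fun h => hc (Finset.mem_sdiff.1 h).1
    simp only [transfer_succ]
    have heR := he R (Nat.lt_succ_self R)
    rcases h : e R with _ | _ | _
    · simp only [rowSum]
      rw [Finset.insert_comm, ih' _ (by
          intro x hx
          rcases Finset.mem_insert.1 hx with rfl | hx
          exacts [by omega, hQ x hx]),
        Finset.sum_powerset_insert hc, ← Finset.sum_add_distrib, mul_add, mul_add, add_sub_add_comm,
        Finset.mul_sum, Finset.mul_sum, ← Finset.sum_sub_distrib]
      congr 1
      -- If `c ∉ A`, column `c` is one more place for the `β`; if `c` receives an `α`, no place is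
      -- left and the weight is `b`. With `L = leftCount Q A`, the two cases combine by `-b (b + L +
      -- 1) + b = -b (b + L)`.
      refine Finset.sum_congr rfl fun A hA => ?_
      rw [h1 A hA, h2, ih' _ (hsub A), leftCount_insert hQ (Finset.mem_powerset.1 hA),
        leftCount_insert_insert hQ]
      push_cast
      ring
    · have hne : R + d ≠ c := heR (by simp [h])
      simp only [rowSum]
      rw [Finset.sum_powerset_insert hc, ← Finset.sum_add_distrib,
        Finset.mul_sum, Finset.mul_sum, ← Finset.sum_sub_distrib]
      refine Finset.sum_congr rfl fun A hA => ?_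
      rw [h1 A hA, h2, ih' _ (hsub A), leftCount_insert hQ (Finset.mem_powerset.1 hA),
        leftCount_insert_insert hQ]
      simp only [Finset.mem_insert, hne, false_or]
      split_ifs
      · push_cast
        ring
      · ring
    · have hne : R + d ≠ c := heR (by simp [h])
      simp only [rowSum, Finset.mem_insert, hne, false_or]
      split_ifs with hm
      · have hlt : R + d < c := hQ _ hm
        rw [Finset.filter_insert, if_neg (by omega), Finset.mul_sum, Finset.mul_sum,
          ← Finset.sum_sub_distrib]
        refine Finset.sum_congr rfl fun A hA => ?_
        have hA' : A ∈ Q.powerset := Finset.mem_powerset.2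
          ((Finset.mem_powerset.1 hA).trans (Finset.filter_subset _ _))
        rw [h1 A hA', ih' _ (hsub A)]
      · ring

/-- The bottom row is the single box of the leftmost column. The `b` from an `α` there cancels the
negative term of `transfer_insert`. -/
theorem transfer_succ_empty {d : ℕ} {e : ℕ → Option ABSymbol} {a b : ℝ} {R : ℕ}
    (he : ∀ i < R + 1, e i ≠ none → i + d < R) :
    transfer d e a b (R + 1) ∅ = (a + b) * transfer d e a (b + 1) R ∅ := by
  have hR : e R = none := by
    by_contra h
    have := he R (Nat.lt_succ_self R) h
    omega
  rw [transfer_succ, hR]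
  simp only [rowSum]
  rw [transfer_insert (by simp) le_rfl fun i hi h => (he i (by omega) h).ne]
  simp [leftCount]

/-- Normalized by the partition function, size `R + m` with parameter `b` agrees with size `R` and
parameter `b + m`; the cross-multiplied form avoids dividing by zero. -/
theorem transfer_add_empty {d : ℕ} {e : ℕ → Option ABSymbol} {a : ℝ} {R : ℕ} (m : ℕ) (b : ℝ)
    (he : ∀ i < R + m, e i ≠ none → i + d < R) :
    transfer d e a b (R + m) ∅ * risingProd a (b + m) R =
      transfer d e a (b + m) R ∅ * risingProd a b (R + m) := by
  induction m generalizing b with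
  | zero => simp
  | succ m ih =>
    have h := ih (b + 1) fun i hi => he i (by omega)
    rw [← add_assoc, transfer_succ_empty fun i hi hi' => (he i (by omega) hi').trans_le (by omega),
      risingProd_succ']
    have hb : b + ((m + 1 : ℕ) : ℝ) = b + 1 + m := by push_cast; ring
    rw [hb]
    linear_combination (a + b) * h

/-- Each additional column multiplies by `a + R`, by `transfer_insert`; for `Q = ∅` and `R = n` this
is the partition function. -/
theorem transfer_eq_of_none {d : ℕ} {e : ℕ → Option ABSymbol} {a : ℝ} {R : ℕ}
    (he : ∀ i < R, e i = none) (b : ℝ) {Q : Finset ℕ} (hQ : ∀ x ∈ Q, R ≤ x) :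
    transfer d e a b R Q = risingProd a b R * (a + R) ^ Q.card := by
  induction R generalizing Q b with
  | zero => simp [transfer, risingProd_zero]
  | succ R ihR =>
    induction Q using Finset.induction_on_max generalizing b with
    | empty =>
      rw [transfer_succ, he R (Nat.lt_succ_self R)]
      simp only [rowSum, leftCount]
      rw [ihR (fun i hi => he i (by omega)) b (by simp)]
      simp only [Finset.powerset_empty, Finset.sum_singleton]
      rw [ihR (fun i hi => he i (by omega)) b (by simp), risingProd_succ]
      simp
      ring
    | insert c Q hc ih =>
      have hQ' : ∀ x ∈ Q, R + 1 ≤ x := fun x hx => hQ x (Finset.mem_insert_of_mem hx)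
      rw [transfer_insert hc (hQ c (Finset.mem_insert_self _ _))
        (fun i hi h => absurd (he i hi) h), ih b hQ', ih (b + 1) hQ',
        Finset.card_insert_of_notMem fun h => lt_irrefl _ (hc c h), ← mul_assoc,
        ← risingProd_succ', risingProd_succ]
      push_cast
      ring

/-- Prescribing a symbol only discards nonnegative terms of the free row sum. -/
theorem rowSum_le_rowSum_none {d : ℕ} {b : ℝ} (hb : 0 ≤ b) {R : ℕ} {o : Option ABSymbol}
    {G H : Finset ℕ → ℝ} (hG : ∀ Q, 0 ≤ G Q) (hGH : ∀ Q, G Q ≤ H Q) (Q : Finset ℕ) :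
    rowSum d b R o G Q ≤ rowSum d b R none H Q := by
  have h : ∀ A, 0 ≤ (b + leftCount Q A) * H (Q \ A) := fun A =>
    mul_nonneg (by positivity) ((hG _).trans (hGH _))
  have h' : ∀ A, (b + leftCount Q A) * G (Q \ A) ≤ (b + leftCount Q A) * H (Q \ A) := fun A =>
    mul_le_mul_of_nonneg_left (hGH _) (by positivity)
  rcases o with _ | _ | _
  · exact add_le_add (hGH _) (Finset.sum_le_sum fun A _ => h' A)
  · refine le_add_of_nonneg_of_le ((hG _).trans (hGH _)) (Finset.sum_le_sum fun A _ => ?_)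
    split_ifs
    exacts [h' A, h A]
  · simp only [rowSum]
    split_ifs with hm
    · refine le_add_of_nonneg_of_le ((hG _).trans (hGH _)) ?_
      refine (Finset.sum_le_sum (g := fun A => (b + leftCount Q A) * H (Q \ A)) fun A hA => ?_).trans
        (Finset.sum_le_sum_of_subset_of_nonneg
          (Finset.powerset_mono.2 (Finset.filter_subset (· < R + d) Q)) fun A _ _ => h A)
      -- The prescribed `β` is itself one of the admissible places counted by `leftCount`, so its
      -- weight `1` is covered.
      have h1 : 1 ≤ leftCount Q A := Finset.card_pos.2 ⟨R + d, Finset.mem_filter.2 ⟨hm, fun x hx =>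
        (Finset.mem_filter.1 (Finset.mem_powerset.1 hA hx)).2⟩⟩
      have h2 : (1 : ℝ) ≤ leftCount Q A := by exact_mod_cast h1
      exact (hGH _).trans (le_mul_of_one_le_left ((hG _).trans (hGH _)) (by linarith))
    · exact add_nonneg ((hG _).trans (hGH _)) (Finset.sum_nonneg fun A _ => h A)

theorem transfer_le_risingProd {d : ℕ} {e : ℕ → Option ABSymbol} {a b : ℝ} (ha : 0 ≤ a)
    (hb : 0 ≤ b) {R : ℕ} {Q : Finset ℕ} (hQ : ∀ x ∈ Q, R ≤ x) :
    transfer d e a b R Q ≤ risingProd a b (R + Q.card) := by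
  have h : ∀ R Q, transfer d e a b R Q ≤ transfer d (fun _ => none) a b R Q := by
    intro R
    induction R with
    | zero => exact fun Q => le_rfl
    | succ R ih => exact rowSum_le_rowSum_none hb (transfer_nonneg ha hb R) ih
  refine (h R Q).trans ?_
  rw [transfer_eq_of_none (by simp) b hQ]
  generalize Q.card = q
  induction q with
  | zero => simp
  | succ q ih =>
    rw [← add_assoc, risingProd_succ, pow_succ, ← mul_assoc]
    refine mul_le_mul ih ?_ (by positivity) (risingProd_nonneg (by positivity) _)
    push_cast
    have : (0 : ℝ) ≤ q := by positivity
    linarith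

/-! ### The exact probability of one symbol -/

/-- The numerator of the probability of a symbol in row `i`, column `i + d`, when `i + d` is the
leftmost column. -/
def symbolNumerator (a b : ℝ) (i : ℕ) : ABSymbol → ℝ
  | ABSymbol.alpha => b
  | ABSymbol.beta => a + i

/-- A column with index at least `R` is available above row `R` only through `Q`, so the prescribed
box cannot be filled. -/
theorem transfer_eq_zero_of_notMem {d : ℕ} {e : ℕ → Option ABSymbol} {a b : ℝ} {i R : ℕ}
    (hi : e i ≠ none) (hR : i < R) (hR' : R ≤ i + d) (he : ∀ l, i < l → l < R → e l = none)
    {Q : Finset ℕ} (hQ : i + d ∉ Q) : transfer d e a b R Q = 0 := by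
  induction R, hR using Nat.le_induction generalizing Q with
  | base =>
    rw [transfer_succ]
    rcases h : e i with _ | _ | _
    · exact absurd h hi
    · refine Finset.sum_eq_zero fun A hA => if_neg fun h => hQ (Finset.mem_powerset.1 hA h)
    · simp [rowSum, hQ]
  | succ R hR ih =>
    have ih' := fun {Q : Finset ℕ} => ih (Q := Q) (by omega) fun l hl hl' => he l hl (by omega)
    have : i < R := hR
    rw [transfer_succ, he R this (Nat.lt_succ_self R)]
    simp only [rowSum]
    rw [ih' (by rw [Finset.mem_insert, not_or]; exact ⟨by omega, hQ⟩), zero_add]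
    refine Finset.sum_eq_zero fun A _ => ?_
    rw [ih' fun h => hQ (Finset.mem_sdiff.1 h).1, mul_zero]

theorem sum_powerset_pow_card_sdiff (y : ℝ) (Q : Finset ℕ) :
    ∑ A ∈ Q.powerset, y ^ (Q \ A).card = (y + 1) ^ Q.card := by
  rw [add_comm, ← Finset.sum_pow_mul_eq_add_pow]
  refine Finset.sum_congr rfl fun A hA => ?_
  rw [Finset.card_sdiff_of_subset (Finset.mem_powerset.1 hA), one_pow, one_mul]

/-- Between rows `i` and `R` the leftmost column may not receive an `α`, as that would empty the
prescribed box, but it offers every row without `β` one more place for it: hence `b + 1`. In row `i`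
an `α` has weight `b` and closes the column, while a `β` leaves it open and produces the factor `a +
i` above. -/
theorem transfer_insert_event {d : ℕ} {e : ℕ → Option ABSymbol} {a b : ℝ} {i : ℕ} {x : ABSymbol}
    (hi : e i = some x) (he : ∀ l < i, e l = none) {R : ℕ} (hR : i < R) (hR' : R ≤ i + d)
    (he' : ∀ l, i < l → l < R → e l = none) {Q : Finset ℕ}
    (hQ : ∀ y ∈ Q, R ≤ y ∧ y < i + d) :
    transfer d e a b R (insert (i + d) Q) * risingProd a (b + 1) (i + 1) =
      symbolNumerator a b i x * risingProd a b i *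
        transfer d (fun _ => none) a (b + 1) R Q := by
  have hdisj : ∀ Q : Finset ℕ, (∀ y ∈ Q, y < i + d) → i + d ∉ Q := fun Q hQ h => lt_irrefl _ (hQ _ h)
  have hins : ∀ A Q : Finset ℕ, (∀ y ∈ Q, y < i + d) → A ∈ Q.powerset →
      insert (i + d) Q \ A = insert (i + d) (Q \ A) := fun A Q hQ hA =>
    Finset.insert_sdiff_of_notMem _ fun h => hdisj Q hQ (Finset.mem_powerset.1 hA h)
  induction R, hR using Nat.le_induction generalizing Q with
  | base =>
    have hlt : ∀ y ∈ Q, y < i + d := fun y hy => (hQ y hy).2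
    have hc := hdisj Q hlt
    have hle : ∀ A, ∀ y ∈ Q \ A, i ≤ y := fun A y hy =>
      (Nat.le_succ i).trans (hQ y (Finset.mem_sdiff.1 hy).1).1
    rw [transfer_eq_of_none (by simp) (b + 1) fun y hy => (hQ y hy).1, transfer_succ, hi]
    push_cast
    rw [← add_assoc, ← sum_powerset_pow_card_sdiff]
    rcases x with _ | _
    · simp only [rowSum, symbolNumerator]
      rw [Finset.sum_powerset_insert hc, Finset.sum_eq_zero fun A hA =>
        if_neg fun h => hc (Finset.mem_powerset.1 hA h), zero_add]
      have : ∀ A ∈ Q.powerset, (if i + d ∈ insert (i + d) A then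
          (b + leftCount (insert (i + d) Q) (insert (i + d) A)) *
            transfer d e a b i (insert (i + d) Q \ insert (i + d) A) else 0) =
          b * risingProd a b i * (a + i) ^ (Q \ A).card := by
        intro A hA
        rw [if_pos (Finset.mem_insert_self _ _), leftCount_insert_insert hlt,
          Finset.insert_sdiff_insert, Finset.sdiff_insert,
          Finset.erase_eq_of_notMem fun h => hc (Finset.mem_sdiff.1 h).1,
          transfer_eq_of_none he b (hle A)]
        simp
        ring
      rw [Finset.sum_congr rfl this, ← Finset.mul_sum]
      ring
    · simp only [rowSum, symbolNumerator]
      rw [if_pos (Finset.mem_insert_self _ _), Finset.filter_insert, if_neg (lt_irrefl _),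
        Finset.filter_true_of_mem hlt]
      have : ∀ A ∈ Q.powerset, transfer d e a b i (insert (i + d) Q \ A) =
          (a + i) * risingProd a b i * (a + i) ^ (Q \ A).card := by
        intro A hA
        rw [hins A Q hlt hA, transfer_eq_of_none he b (by
          intro y hy
          rcases Finset.mem_insert.1 hy with rfl | hy
          exacts [Nat.le_add_right _ _, hle A y hy]),
          Finset.card_insert_of_notMem fun h => hc (Finset.mem_sdiff.1 h).1]
        ring
      rw [Finset.sum_congr rfl this, ← Finset.mul_sum]
      ring
  | succ R hR ih =>
    have hiR : i < R := hR
    have hlt : ∀ y ∈ Q, y < i + d := fun y hy => (hQ y hy).2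
    have hc := hdisj Q hlt
    have he'' : ∀ l, i < l → l < R → e l = none := fun l hl hl' => he' l hl (by omega)
    have ih' := fun (Q : Finset ℕ) hQ => ih (Q := Q) (by omega) he'' hQ
    rw [transfer_succ, transfer_succ, he' R hiR (Nat.lt_succ_self R)]
    simp only [rowSum]
    rw [Finset.sum_powerset_insert hc, ← Finset.sum_add_distrib, Finset.insert_comm, add_mul,
      mul_add, ih' _ (by
        intro y hy
        rcases Finset.mem_insert.1 hy with rfl | hy
        exacts [⟨le_rfl, by omega⟩, ⟨by have := (hQ y hy).1; omega, hlt y hy⟩]),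
      Finset.sum_mul, Finset.mul_sum]
    congr 1
    refine Finset.sum_congr rfl fun A hA => ?_
    rw [leftCount_insert hlt (Finset.mem_powerset.1 hA), hins A Q hlt hA,
      Finset.insert_sdiff_insert, Finset.sdiff_insert,
      Finset.erase_eq_of_notMem fun h => hc (Finset.mem_sdiff.1 h).1,
      transfer_eq_zero_of_notMem (by simp [hi]) hiR (by omega) he''
        fun h => hc (Finset.mem_sdiff.1 h).1]
    have := ih' (Q \ A) fun y hy => by
      have := hQ y (Finset.mem_sdiff.1 hy).1
      omega
    push_cast
    linear_combination (b + leftCount Q A + 1) * this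

/-- The probability of a symbol in row `i` and column `i + d`, where `B = b + n`. -/
noncomputable def symbolProb (d : ℕ) (a B : ℝ) (i : ℕ) : Option ABSymbol → ℝ
  | none => 1
  | some x => symbolNumerator a (B - (i + d) - 1) i x / ((B + a - d) * (B + a - d - 1))

/-- The columns left of `i + d` are removed first, each raising `b` by one, so that `b + R` is
preserved; then `transfer_insert_event` applies with `Q = ∅`. -/
theorem transfer_single {d : ℕ} (hd : 1 ≤ d) {e : ℕ → Option ABSymbol} {a b : ℝ} (ha : 0 < a)
    (hb : 0 < b) {i R : ℕ} {x : ABSymbol} (hi : e i = some x) (hR : i + d < R)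
    (he : ∀ l < R, l ≠ i → e l = none) :
    transfer d e a b R ∅ = symbolProb d a (b + R) i (some x) * risingProd a b R := by
  obtain ⟨m, rfl⟩ := Nat.exists_eq_add_of_lt hR
  have hbm : 0 < b + m := by positivity
  have hRm : i + d + m + 1 = i + d + 1 + m := by ring
  have h1 := transfer_add_empty (d := d) (e := e) (a := a) (R := i + d + 1) m b (by
    intro l hl hl'
    rcases eq_or_ne l i with rfl | h
    · exact Nat.lt_succ_self _
    · exact absurd (he l (by omega) h) hl')
  rw [hRm]
  have h2 := transfer_insert_event (d := d) (a := a) (b := b + m) hi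
    (fun l hl => he l (by omega) hl.ne) (R := i + d) (by omega) le_rfl
    (fun l hl hl' => he l (by omega) hl.ne') (Q := ∅) (by simp)
  -- The corner of row `i + d` is in the column of the symbol, so it must be `β`: an `α` there would
  -- close the column.
  have h3 : transfer d e a (b + m) (i + d + 1) ∅ =
      transfer d e a (b + m) (i + d) (insert (i + d) ∅) := by
    rw [transfer_succ, he (i + d) (by omega) (by omega)]
    have hz : transfer d e a (b + m) (i + d) ∅ = 0 := transfer_eq_zero_of_notMem (by simp [hi])
      (by omega) le_rfl (fun l hl hl' => he l (by omega) hl.ne') (by simp)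
    simp [rowSum, hz]
  rw [transfer_eq_of_none (e := fun _ => none) (by simp) _ (by simp), ← h3] at h2
  -- The normalizations at `b + m` and `b + m + 1` differ by the first factor `a + b + m`. After
  -- cancelling the first `i` factors, two remain and form the denominator.
  have h4 : (b + m + a + i) * (b + m + a + i + 1) * transfer d e a (b + m) (i + d + 1) ∅ =
      symbolNumerator a (b + m) i x * risingProd a (b + m) (i + d + 1) := by
    have hp := risingProd_pos (a := a) (b := b + m) (by positivity) i
    have hs : risingProd a (b + m) (i + 1 + 1) = (a + (b + m)) * risingProd a (b + m + 1) (i + 1) :=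
      risingProd_succ' _ _ _
    rw [risingProd_succ, risingProd_succ] at hs
    refine mul_left_cancel₀ hp.ne' ?_
    rw [risingProd_succ' a (b + m) (i + d)]
    simp only [Finset.card_empty, pow_zero, mul_one] at h2
    push_cast at hs
    linear_combination (a + (b + m)) * h2 + transfer d e a (b + m) (i + d + 1) ∅ * hs
  have hp := risingProd_pos (a := a) (b := b + m) (by positivity) (i + d + 1)
  have h5 : (0 : ℝ) < b + m + a + i := by positivity
  simp only [symbolProb]
  push_cast
  have e1 : b + (i + d + 1 + m : ℝ) - (i + d) - 1 = b + m := by ring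
  have e2 : b + (i + d + 1 + m : ℝ) + a - d = b + m + a + i + 1 := by ring
  have e3 : b + m + a + i + 1 - 1 = b + m + a + i := by ring
  rw [e1, e2, e3, div_mul_eq_mul_div, eq_div_iff (by positivity)]
  refine mul_right_cancel₀ hp.ne' ?_
  linear_combination (b + m + a + i) * (b + m + a + i + 1) * h1 + risingProd a b (i + d + 1 + m) * h4

/-! ### How one row acts on bounds relative to the partition function -/

section Propagation

variable {a b : ℝ}

/-- Removing `A` and one row shrinks the size by at most `|Q| + 1`, hence by at most the factor `|Q|
+ 2` since the smaller size is at least `1`. -/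
theorem rowSum_term_le (ha : 0 ≤ a) (hb : 0 ≤ b) {R s : ℕ} {W : Finset ℕ → ℝ} {C : ℝ}
    {Q A : Finset ℕ} (hA : A ⊆ Q)
    (hW : |W (Q \ A)| * (R + (Q \ A).card + a + b + 1) ^ s ≤ C * risingProd a b (R + (Q \ A).card)) :
    |W (Q \ A)| * ((R + 1 : ℕ) + Q.card + a + b + 1) ^ s ≤
      (Q.card + 2) ^ s * C * risingProd a b (R + (Q \ A).card) := by
  have hcard : Q.card = (Q \ A).card + A.card := (Finset.card_sdiff_add_card_eq_card hA).symm
  have hq : (Q.card : ℝ) = (Q \ A).card + A.card := by exact_mod_cast hcard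
  set M' : ℝ := R + (Q \ A).card + a + b + 1 with hM'
  have h1 : 1 ≤ M' := by
    have : (0 : ℝ) ≤ R + (Q \ A).card := by positivity
    linarith
  have hM : ((R + 1 : ℕ) : ℝ) + Q.card + a + b + 1 ≤ (Q.card + 2) * M' := by
    push_cast
    have : (0 : ℝ) ≤ (Q \ A).card := by positivity
    nlinarith [mul_le_mul_of_nonneg_left h1 (show (0 : ℝ) ≤ Q.card + 1 by positivity)]
  calc |W (Q \ A)| * ((R + 1 : ℕ) + Q.card + a + b + 1) ^ s
      ≤ |W (Q \ A)| * ((Q.card + 2) * M') ^ s := by gcongr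
    _ = (Q.card + 2) ^ s * (|W (Q \ A)| * M' ^ s) := by rw [mul_pow]; ring
    _ ≤ (Q.card + 2) ^ s * (C * risingProd a b (R + (Q \ A).card)) := by gcongr
    _ = _ := by ring

/-- The next factor `a + b + R + |Q \ A|` of the rising factorial dominates `b + leftCount Q A`. -/
theorem add_leftCount_mul_risingProd_le (ha : 0 ≤ a) (hb : 0 ≤ b) (R : ℕ) (Q A : Finset ℕ) :
    (b + leftCount Q A) * risingProd a b (R + (Q \ A).card) ≤
      risingProd a b (R + (Q \ A).card + 1) := by
  rw [risingProd_succ, mul_comm]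
  refine mul_le_mul_of_nonneg_left ?_ (risingProd_nonneg (by positivity) _)
  have : (leftCount Q A : ℝ) ≤ (Q \ A).card := by exact_mod_cast leftCount_le_card_sdiff Q A
  push_cast
  have : (0 : ℝ) ≤ R := by positivity
  linarith

/-- There are at most `2 ^ D` sets `A`, and each term is absorbed into the larger partition
function, so only a constant is lost. -/
theorem abs_rowSum_none_le (ha : 0 ≤ a) (hb : 0 ≤ b) {d R s D : ℕ} {W : Finset ℕ → ℝ} {C : ℝ}
    (hC : 0 ≤ C) {Q : Finset ℕ} (hQ : ∀ y ∈ Q, R < y) (hQD : Q.card ≤ D)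
    (hW : ∀ Q' : Finset ℕ, Q'.card ≤ Q.card + 1 → (∀ y ∈ Q', R ≤ y) →
      |W Q'| * (R + Q'.card + a + b + 1) ^ s ≤ C * risingProd a b (R + Q'.card)) :
    |rowSum d b R none W Q| * ((R + 1 : ℕ) + Q.card + a + b + 1) ^ s ≤
      (1 + 2 ^ D * (D + 2) ^ s) * C * risingProd a b (R + 1 + Q.card) := by
  set M : ℝ := (R + 1 : ℕ) + Q.card + a + b + 1 with hM
  have hM0 : 0 ≤ M := by positivity
  have hZ := risingProd_nonneg (a := a) (b := b) (by positivity) (R + 1 + Q.card)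
  have hcard : (insert R Q).card = Q.card + 1 :=
    Finset.card_insert_of_notMem fun h => lt_irrefl _ (hQ R h)
  have h1 : |W (insert R Q)| * M ^ s ≤ C * risingProd a b (R + 1 + Q.card) := by
    have := hW (insert R Q) hcard.le (by
      intro y hy
      rcases Finset.mem_insert.1 hy with rfl | hy
      exacts [le_rfl, (hQ y hy).le])
    rw [hcard] at this
    convert this using 3
    · rw [hM]; push_cast; ring
    · ring
  have h2 : ∀ A ∈ Q.powerset, |(b + leftCount Q A) * W (Q \ A)| * M ^ s ≤
      (D + 2) ^ s * C * risingProd a b (R + 1 + Q.card) := by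
    intro A hA
    have hAQ := Finset.mem_powerset.1 hA
    have hle : (Q \ A).card ≤ Q.card := Finset.card_le_card Finset.sdiff_subset
    have ht := rowSum_term_le ha hb hAQ (hW (Q \ A) (by omega)
      fun y hy => (hQ y (Finset.mem_sdiff.1 hy).1).le)
    have hb' : 0 ≤ b + leftCount Q A := by positivity
    rw [abs_mul, abs_of_nonneg hb']
    calc (b + leftCount Q A) * |W (Q \ A)| * M ^ s
        = (b + leftCount Q A) * (|W (Q \ A)| * M ^ s) := by ring
      _ ≤ (b + leftCount Q A) * ((Q.card + 2) ^ s * C * risingProd a b (R + (Q \ A).card)) := by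
          gcongr
      _ = (Q.card + 2) ^ s * C * ((b + leftCount Q A) * risingProd a b (R + (Q \ A).card)) := by
          ring
      _ ≤ (Q.card + 2) ^ s * C * risingProd a b (R + (Q \ A).card + 1) := by
          gcongr
          exact add_leftCount_mul_risingProd_le ha hb R Q A
      _ ≤ (D + 2) ^ s * C * risingProd a b (R + 1 + Q.card) := by
          have : (Q.card : ℝ) ≤ D := by exact_mod_cast hQD
          have := risingProd_mono (a := a) (b := b) (by positivity)
            (m := R + (Q \ A).card + 1) (m' := R + 1 + Q.card) (by omega) (by omega)
          gcongr
          exact risingProd_nonneg (by positivity) _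
  calc |rowSum d b R none W Q| * M ^ s
      ≤ (|W (insert R Q)| + ∑ A ∈ Q.powerset, |(b + leftCount Q A) * W (Q \ A)|) * M ^ s := by
        gcongr
        exact (abs_add_le _ _).trans (by gcongr; exact Finset.abs_sum_le_sum_abs _ _)
    _ ≤ C * risingProd a b (R + 1 + Q.card) +
        ∑ A ∈ Q.powerset, (D + 2) ^ s * C * risingProd a b (R + 1 + Q.card) := by
        rw [add_mul, Finset.sum_mul]
        exact add_le_add h1 (Finset.sum_le_sum h2)
    _ = C * risingProd a b (R + 1 + Q.card) +
        2 ^ Q.card * ((D + 2) ^ s * C * risingProd a b (R + 1 + Q.card)) := by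
        rw [Finset.sum_const, Finset.card_powerset, nsmul_eq_mul]; push_cast; rfl
    _ ≤ C * risingProd a b (R + 1 + Q.card) +
        2 ^ D * ((D + 2) ^ s * C * risingProd a b (R + 1 + Q.card)) := by
        gcongr
        norm_num
    _ = _ := by ring

/-- A prescribed `α` forces `A` to be nonempty, and a prescribed `β` removes the factor `b +
leftCount` and keeps `Q \ A` nonempty. Either way the terms fit into the rising factorial of length
`R + |Q|`, one factor short, and the spare factor `a + b + R + |Q|` supplies the extra power of the
size. -/
theorem abs_rowSum_some_le (ha : 0 ≤ a) (hb : 0 ≤ b) {d R s D : ℕ} {x : ABSymbol}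
    {W : Finset ℕ → ℝ} {C : ℝ}
    (hC : 0 ≤ C) {Q : Finset ℕ} (hQ : ∀ y ∈ Q, R < y) (hQD : Q.card ≤ D)
    (hW : ∀ Q' : Finset ℕ, Q'.card ≤ Q.card + 1 → (∀ y ∈ Q', R ≤ y) →
      |W Q'| * (R + Q'.card + a + b + 1) ^ s ≤ C * risingProd a b (R + Q'.card)) :
    |rowSum d b R (some x) W Q| * ((R + 1 : ℕ) + Q.card + a + b + 1) ^ (s + 1) ≤
      3 * 2 ^ D * (D + 2) ^ s * C * risingProd a b (R + 1 + Q.card) := by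
  set M : ℝ := (R + 1 : ℕ) + Q.card + a + b + 1 with hM
  have hM0 : 0 ≤ M := by positivity
  have hZ := risingProd_nonneg (a := a) (b := b) (by positivity) (R + 1 + Q.card)
  have hpos : 0 ≤ (3 : ℝ) * (D + 2) ^ s * C * risingProd a b (R + 1 + Q.card) := by positivity
  have hQD' : (Q.card : ℝ) ≤ D := by exact_mod_cast hQD
  have hterm : ∀ (A : Finset ℕ) (u : ℝ), A ⊆ Q → Q.Nonempty → 0 ≤ u →
      u * risingProd a b (R + (Q \ A).card) ≤ risingProd a b (R + Q.card) →
      |u * W (Q \ A)| * M ^ (s + 1) ≤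
        3 * (D + 2) ^ s * C * risingProd a b (R + 1 + Q.card) := by
    intro A u hAQ hne hu huZ
    have hle : (Q \ A).card ≤ Q.card := Finset.card_le_card Finset.sdiff_subset
    have ht := rowSum_term_le ha hb hAQ (hW (Q \ A) (by omega)
      fun y hy => (hQ y (Finset.mem_sdiff.1 hy).1).le)
    have h1 : (1 : ℝ) ≤ Q.card := by exact_mod_cast hne.card_pos
    have hM3 : M ≤ 3 * (a + b + (R + Q.card)) := by
      rw [hM]
      push_cast
      have : (0 : ℝ) ≤ R := by positivity
      linarith
    have hZ' := risingProd_nonneg (a := a) (b := b) (by positivity) (R + Q.card)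
    have hZ'' := risingProd_nonneg (a := a) (b := b) (by positivity) (R + (Q \ A).card)
    rw [abs_mul, abs_of_nonneg hu]
    calc u * |W (Q \ A)| * M ^ (s + 1) = u * (|W (Q \ A)| * M ^ s) * M := by ring
      _ ≤ u * ((Q.card + 2) ^ s * C * risingProd a b (R + (Q \ A).card)) * M := by gcongr
      _ = (Q.card + 2) ^ s * C * (u * risingProd a b (R + (Q \ A).card)) * M := by ring
      _ ≤ (D + 2) ^ s * C * risingProd a b (R + Q.card) * (3 * (a + b + (R + Q.card))) := by
          gcongr
      _ = 3 * (D + 2) ^ s * C * risingProd a b (R + 1 + Q.card) := by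
          rw [show R + 1 + Q.card = R + Q.card + 1 by ring, risingProd_succ]; push_cast; ring
  have hsum : ∀ (S : Finset (Finset ℕ)) (f : Finset ℕ → ℝ), S ⊆ Q.powerset →
      (∀ A ∈ S, |f A| * M ^ (s + 1) ≤ 3 * (D + 2) ^ s * C * risingProd a b (R + 1 + Q.card)) →
      |∑ A ∈ S, f A| * M ^ (s + 1) ≤
        3 * 2 ^ D * (D + 2) ^ s * C * risingProd a b (R + 1 + Q.card) := by
    intro S f hS hf
    have hcard : (S.card : ℝ) ≤ 2 ^ D := by
      have h1 := Finset.card_le_card hS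
      rw [Finset.card_powerset] at h1
      exact_mod_cast h1.trans (Nat.pow_le_pow_right (by norm_num) hQD)
    calc |∑ A ∈ S, f A| * M ^ (s + 1) ≤ (∑ A ∈ S, |f A|) * M ^ (s + 1) := by
          gcongr; exact Finset.abs_sum_le_sum_abs _ _
      _ ≤ ∑ A ∈ S, 3 * (D + 2) ^ s * C * risingProd a b (R + 1 + Q.card) := by
          rw [Finset.sum_mul]; exact Finset.sum_le_sum hf
      _ ≤ 2 ^ D * (3 * (D + 2) ^ s * C * risingProd a b (R + 1 + Q.card)) := by
          rw [Finset.sum_const, nsmul_eq_mul]; gcongr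
      _ = _ := by ring
  rcases x with _ | _
  · refine hsum _ _ subset_rfl fun A hA => ?_
    have hAQ := Finset.mem_powerset.1 hA
    split_ifs with hm
    · have hs := Finset.card_sdiff_add_card_eq_card hAQ
      have hA1 : 1 ≤ A.card := Finset.card_pos.2 ⟨_, hm⟩
      refine hterm A _ hAQ ⟨_, hAQ hm⟩ (by positivity) ?_
      exact (add_leftCount_mul_risingProd_le ha hb R Q A).trans
        (risingProd_mono (by positivity) (by omega) (by omega))
    · simpa using hpos
  · simp only [rowSum]
    split_ifs with hm
    · refine hsum _ _ (Finset.powerset_mono.2 (Finset.filter_subset _ _)) fun A hA => ?_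
      have hA' := Finset.mem_powerset.1 hA
      have hAQ := hA'.trans (Finset.filter_subset _ _)
      have hs := Finset.card_sdiff_add_card_eq_card hAQ
      have h1 : 1 ≤ (Q \ A).card := Finset.card_pos.2 ⟨_, Finset.mem_sdiff.2 ⟨hm, fun h =>
        lt_irrefl _ (Finset.mem_filter.1 (hA' h)).2⟩⟩
      have := hterm A 1 hAQ ⟨_, hm⟩ zero_le_one (by
        rw [one_mul]
        exact risingProd_mono (by positivity) (by omega) (by omega))
      rwa [one_mul] at this
    · have : 0 ≤ (3 : ℝ) * 2 ^ D * (D + 2) ^ s * C * risingProd a b (R + 1 + Q.card) := by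
        positivity
      simpa using this

/-- The factor lost by `abs_le_of_rowSum`. -/
noncomputable def rowSumFactor (d s : ℕ) : ℝ :=
  3 * 2 ^ d * (d + 2) ^ s * (1 + 2 ^ d * (d + 2) ^ (s + 1)) ^ d

theorem rowSumFactor_nonneg (d s : ℕ) : 0 ≤ rowSumFactor d s := by
  unfold rowSumFactor
  positivity

/-- A row with a prescribed symbol gains a power of the size; the following rows lose only a
constant factor. -/
theorem abs_le_of_rowSum (ha : 0 ≤ a) (hb : 0 ≤ b) {d s i t : ℕ} {x : ABSymbol}
    {F : ℕ → Finset ℕ → ℝ} {C : ℝ} (hC : 0 ≤ C) (hi : F (i + 1) = rowSum d b i (some x) (F i))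
    (hF : ∀ l, i < l → l < i + 1 + t → F (l + 1) = rowSum d b l none (F l))
    (h : ∀ Q : Finset ℕ, Q.card ≤ d + 1 → (∀ y ∈ Q, i ≤ y) →
      |F i Q| * (i + Q.card + a + b + 1) ^ s ≤ C * risingProd a b (i + Q.card))
    {Q : Finset ℕ} (hQ : ∀ y ∈ Q, i + 1 + t ≤ y) (hQt : Q.card + t ≤ d) :
    |F (i + 1 + t) Q| * ((i + 1 + t : ℕ) + Q.card + a + b + 1) ^ (s + 1) ≤
      rowSumFactor d s * C * risingProd a b (i + 1 + t + Q.card) := by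
  have key : |F (i + 1 + t) Q| * ((i + 1 + t : ℕ) + Q.card + a + b + 1) ^ (s + 1) ≤
      3 * 2 ^ d * (d + 2) ^ s * (1 + 2 ^ d * (d + 2) ^ (s + 1)) ^ t * C *
        risingProd a b (i + 1 + t + Q.card) := by
    -- Passing to the row above may add one free column, so `|Q| + t ≤ d` is preserved and at most
    -- `d + 1` columns are free above row `i`.
    induction t generalizing Q with
    | zero =>
      simp only [add_zero] at hQ ⊢
      rw [hi]
      refine (abs_rowSum_some_le ha hb hC (D := d) (fun y hy => hQ y hy) (by omega)
        fun Q' h1 h2 => h Q' (by omega) h2).trans (le_of_eq ?_)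
      ring
    | succ t ih =>
      have hrec := hF (i + 1 + t) (by omega) (by omega)
      rw [← add_assoc, hrec]
      refine (abs_rowSum_none_le ha hb (D := d)
        (C := 3 * 2 ^ d * (d + 2) ^ s * (1 + 2 ^ d * (d + 2) ^ (s + 1)) ^ t * C) (by positivity)
        (fun y hy => by have := hQ y hy; omega) (by omega) fun Q' h1 h2 =>
          ih (fun l hl hl' => hF l hl (by omega)) h2 (by omega)).trans (le_of_eq ?_)
      rw [pow_succ]
      ring
  refine key.trans ?_
  have hZ := risingProd_nonneg (a := a) (b := b) (by positivity) (i + 1 + t + Q.card)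
  unfold rowSumFactor
  gcongr
  · have : (0 : ℝ) ≤ 2 ^ d * (d + 2) ^ (s + 1) := by positivity
    linarith
  · omega

end Propagation

/-! ### The order of magnitude for arbitrary positions -/

/-- The number of prescribed symbols in the first `R` rows. -/
def eventCount (e : ℕ → Option ABSymbol) (R : ℕ) : ℕ :=
  ((Finset.range R).filter fun i => e i ≠ none).card

theorem eventCount_succ (e : ℕ → Option ABSymbol) (R : ℕ) :
    eventCount e (R + 1) = eventCount e R + if e R ≠ none then 1 else 0 := by
  unfold eventCount
  rw [Finset.range_add_one, Finset.filter_insert]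
  split_ifs
  · rw [Finset.card_insert_of_notMem (by simp)]
  · rfl

theorem eq_none_of_eventCount_eq_zero {e : ℕ → Option ABSymbol} {R : ℕ} (h : eventCount e R = 0) :
    ∀ i < R, e i = none := by
  intro i hi
  by_contra hne
  rw [eventCount, Finset.card_eq_zero] at h
  exact Finset.notMem_empty i (h ▸ Finset.mem_filter.2 ⟨Finset.mem_range.2 hi, hne⟩)

theorem exists_last_event {e : ℕ → Option ABSymbol} {R r : ℕ} (h : eventCount e R = r + 1) :
    ∃ i x, i < R ∧ e i = some x ∧ (∀ l, i < l → l < R → e l = none) ∧ eventCount e i = r := by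
  induction R with
  | zero => simp [eventCount] at h
  | succ R ih =>
    rw [eventCount_succ] at h
    by_cases hR : e R = none
    · rw [if_neg (by simpa using hR)] at h
      obtain ⟨i, x, hi, hx, hn, hc⟩ := ih h
      refine ⟨i, x, by omega, hx, fun l hl hl' => ?_, hc⟩
      rcases Nat.lt_succ_iff_lt_or_eq.1 hl' with hl' | rfl
      exacts [hn l hl hl', hR]
    · obtain ⟨x, hx⟩ := Option.ne_none_iff_exists'.1 hR
      rw [if_pos hR] at h
      exact ⟨R, x, Nat.lt_succ_self R, hx, fun l hl hl' => by omega, by omega⟩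

theorem transfer_mul_pow_le (d r : ℕ) : ∃ C : ℝ, 0 ≤ C ∧
    ∀ (e : ℕ → Option ABSymbol) (a b : ℝ) (R : ℕ) (Q : Finset ℕ), 0 ≤ a → 0 ≤ b →
      (∀ y ∈ Q, R ≤ y) → eventCount e R = r →
      transfer d e a b R Q * (R + Q.card + a + b + 1) ^ r ≤ C * risingProd a b (R + Q.card) := by
  induction r with
  | zero =>
    refine ⟨1, zero_le_one, fun e a b R Q ha hb hQ _ => ?_⟩
    rw [pow_zero, mul_one, one_mul]
    exact transfer_le_risingProd ha hb hQ
  | succ r ihr =>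
    obtain ⟨C, hC, h⟩ := ihr
    have hK := rowSumFactor_nonneg d r
    refine ⟨rowSumFactor d r * C, by positivity, fun e a b R Q ha hb hQ hr => ?_⟩
    obtain ⟨i, x, hi, hx, hn, hc⟩ := exists_last_event hr
    -- As long as all rows and columns stay within `i + d`, there are at most `d` steps after the
    -- last symbol and the propagation bound suffices.
    have near : ∀ (R : ℕ) (b : ℝ) (Q : Finset ℕ), 0 ≤ b → i < R → R ≤ i + d + 1 →
        (∀ l, i < l → l < R → e l = none) → (∀ y ∈ Q, R ≤ y ∧ y ≤ i + d) →
        transfer d e a b R Q * (R + Q.card + a + b + 1) ^ (r + 1) ≤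
          rowSumFactor d r * C * risingProd a b (R + Q.card) := by
      intro R b Q hb hi hR hn hQ
      obtain ⟨t, rfl⟩ := Nat.exists_eq_add_of_lt hi
      have hcard : Q.card ≤ i + d + 1 - (i + t + 1) := by
        rw [← Nat.card_Icc]
        exact Finset.card_le_card fun y hy => Finset.mem_Icc.2 (hQ y hy)
      rw [show i + t + 1 = i + 1 + t by ring] at *
      have := abs_le_of_rowSum (d := d) (s := r) (t := t) ha hb hC (F := transfer d e a b)
        (by rw [← hx]; rfl) (fun l hl hl' => by rw [← hn l hl hl']; rfl)
        (fun Q' _ hQ' => by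
          rw [abs_of_nonneg (transfer_nonneg ha hb _ _)]
          exact h e a b i Q' ha hb hQ' hc) (fun y hy => (hQ y hy).1) (by omega)
      rwa [abs_of_nonneg (transfer_nonneg ha hb _ _)] at this
    -- Columns beyond `i + d` carry no prescribed symbol. Adding them by `transfer_insert`, with its
    -- negative term dropped, costs no constant: the size plus `b` is unchanged and `a + b`
    -- completes the rising factorial.
    have extend : ∀ R : ℕ, i < R → (∀ l, i < l → l < R → e l = none) →
        (∀ b : ℝ, 0 ≤ b → transfer d e a b R ∅ * (R + a + b + 1) ^ (r + 1) ≤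
          rowSumFactor d r * C * risingProd a b R) → ∀ (Q : Finset ℕ) (b : ℝ),
        0 ≤ b → (∀ y ∈ Q, R ≤ y) → transfer d e a b R Q * (R + Q.card + a + b + 1) ^ (r + 1) ≤
          rowSumFactor d r * C * risingProd a b (R + Q.card) := by
      intro R hi hn hempty Q
      induction Q using Finset.induction_on_max with
      | empty => exact fun b hb _ => by simpa using hempty b hb
      | insert y Q hy ihQ =>
        intro b hb hQ
        have hRy := hQ y (Finset.mem_insert_self _ _)
        rcases le_or_gt y (i + d) with hyc | hyc
        · refine near R b _ hb hi (by omega) hn fun z hz => ⟨hQ z hz, ?_⟩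
          rcases Finset.mem_insert.1 hz with rfl | hz
          exacts [hyc, (hy z hz).le.trans hyc]
        · have h1 := ihQ (b + 1) (by positivity) fun z hz => hQ z (Finset.mem_insert_of_mem hz)
          rw [transfer_insert hy hRy, Finset.card_insert_of_notMem fun h => lt_irrefl _ (hy y h),
            ← add_assoc, risingProd_succ']
          · have h2 := mul_nonneg hb (transfer_nonneg (d := d) (e := e) ha hb R Q)
            have e1 : (R : ℝ) + (Q.card + 1 : ℕ) + a + b + 1 = R + Q.card + a + (b + 1) + 1 := by
              push_cast; ring
            rw [e1]
            calc _ ≤ ((a + b) * transfer d e a (b + 1) R Q) *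
                  (R + Q.card + a + (b + 1) + 1) ^ (r + 1) := by gcongr; linarith
              _ = (a + b) * (transfer d e a (b + 1) R Q *
                  (R + Q.card + a + (b + 1) + 1) ^ (r + 1)) := by ring
              _ ≤ (a + b) * (rowSumFactor d r * C * risingProd a (b + 1) (R + Q.card)) := by gcongr
              _ = _ := by ring
          · intro l hl hl'
            have : l ≤ i := by
              by_contra hli
              exact hl' (hn l (by omega) hl)
            omega
    -- Rows beyond `i + d` are removed exactly, together with their columns, again without loss in
    -- the constant.
    have key : ∀ (R : ℕ), i < R → (∀ l, i < l → l < R → e l = none) → ∀ (b : ℝ), 0 ≤ b →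
        transfer d e a b R ∅ * (R + a + b + 1) ^ (r + 1) ≤
          rowSumFactor d r * C * risingProd a b R := by
      intro R hi
      induction R, hi using Nat.le_induction with
      | base =>
        intro hn b hb
        simpa using near _ b ∅ hb (by omega) (by omega) hn (by simp)
      | succ R hiR ihR =>
        intro hn b hb
        rcases le_or_gt R (i + d) with hR | hR
        · simpa using near _ b ∅ hb (by omega) (by omega) hn (by simp)
        · have h1 := ihR (fun l hl hl' => hn l hl (by omega)) (b + 1) (by positivity)
          rw [transfer_succ_empty, risingProd_succ']
          · have e1 : ((R + 1 : ℕ) : ℝ) + a + b + 1 = R + a + (b + 1) + 1 := by push_cast; ring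
            rw [e1]
            calc _ = (a + b) * (transfer d e a (b + 1) R ∅ * (R + a + (b + 1) + 1) ^ (r + 1)) := by
                  ring
              _ ≤ (a + b) * (rowSumFactor d r * C * risingProd a (b + 1) R) := by gcongr
              _ = _ := by ring
          · intro l hl hl'
            have : l ≤ i := by
              by_contra hli
              exact hl' (hn l (by omega) hl)
            omega
    exact extend R hi hn (key R hi hn) Q b hb hQ

/-! ### Perturbation of the main term -/

theorem abs_div_sub_div_le {m m' D δ : ℝ} (hD : 0 < D) (hδ : 0 ≤ δ) (hD' : 1 ≤ D + δ) (hm : 0 ≤ m)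
    (hmD : m ≤ D) (hmm : |m - m'| ≤ δ) :
    |m / ((D + 1) * D) - m' / ((D + δ + 1) * (D + δ))| ≤ 6 * δ / (D + 1) ^ 2 := by
  have h1 : m / ((D + 1) * D) - m' / ((D + δ + 1) * (D + δ)) =
      m / D * (δ * (D + (D + δ) + 1) / ((D + 1) * ((D + δ + 1) * (D + δ)))) +
        (m - m') / ((D + δ + 1) * (D + δ)) := by
    field_simp
    ring
  -- `D` may be arbitrarily close to `0`, so the singular factor `1 / D` is kept together with `m`.
  have h2 : m / D ≤ 1 := (div_le_one hD).2 hmD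
  have h3 : δ * (D + (D + δ) + 1) / ((D + 1) * ((D + δ + 1) * (D + δ))) ≤ 4 * δ / (D + 1) ^ 2 := by
    rw [div_le_div_iff₀ (by positivity) (by positivity)]
    have : (D + (D + δ) + 1) * (D + 1) ≤ 4 * ((D + δ + 1) * (D + δ)) := by nlinarith
    nlinarith [mul_le_mul_of_nonneg_left this (show 0 ≤ δ * (D + 1) by positivity)]
  have h4 : |(m - m') / ((D + δ + 1) * (D + δ))| ≤ 2 * δ / (D + 1) ^ 2 := by
    rw [abs_div, abs_of_pos (show 0 < (D + δ + 1) * (D + δ) by positivity),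
      div_le_div_iff₀ (by positivity) (by positivity)]
    have : (D + 1) ^ 2 ≤ 2 * ((D + δ + 1) * (D + δ)) := by nlinarith
    calc |m - m'| * (D + 1) ^ 2 ≤ δ * (2 * ((D + δ + 1) * (D + δ))) := by gcongr
      _ = _ := by ring
  have h5 : 0 ≤ m / D := by positivity
  have h6 : 0 ≤ δ * (D + (D + δ) + 1) / ((D + 1) * ((D + δ + 1) * (D + δ))) := by positivity
  rw [h1]
  refine (abs_add_le _ _).trans ?_
  rw [abs_of_nonneg (mul_nonneg h5 h6)]
  calc _ ≤ 1 * (4 * δ / (D + 1) ^ 2) + 2 * δ / (D + 1) ^ 2 := by gcongr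
    _ = _ := by ring

theorem symbolProb_bounds {d : ℕ} {a B : ℝ} (ha : 0 ≤ a) {i m : ℕ} (him : i + d + 1 ≤ m)
    (hB : (m : ℝ) < B) (x : ABSymbol) :
    0 ≤ symbolNumerator a (B - (i + d) - 1) i x ∧
      symbolNumerator a (B - (i + d) - 1) i x ≤ B + a - d - 1 := by
  have h1 : (i : ℝ) + d + 1 ≤ m := by exact_mod_cast him
  have h2 : (0 : ℝ) ≤ i := by positivity
  rcases x with _ | _ <;> simp only [symbolNumerator] <;> constructor <;> linarith

theorem abs_symbolProb_le {d : ℕ} {a B M : ℝ} (ha : 0 ≤ a) {i m : ℕ} (him : i + d + 1 ≤ m)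
    (hB : (m : ℝ) < B) (hM : 0 < M) (hMB : M ≤ B + a + 1) (x : ABSymbol) :
    |symbolProb d a B i (some x)| ≤ (d + 2) / M := by
  obtain ⟨h1, h2⟩ := symbolProb_bounds ha him hB x
  have h3 : (i : ℝ) + d + 1 ≤ m := by exact_mod_cast him
  have hi : (0 : ℝ) ≤ i := by positivity
  have hd : (0 : ℝ) ≤ d := by positivity
  have hD : 0 < B + a - d - 1 := by linarith
  have hD' : 0 < B + a - d := by linarith
  rw [symbolProb, abs_of_nonneg (by positivity), div_le_div_iff₀ (by positivity) hM]
  have h4 : M ≤ (d + 2) * (B + a - d) := by nlinarith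
  calc _ ≤ (B + a - d - 1) * ((d + 2) * (B + a - d)) := by gcongr
    _ = _ := by ring

/-- A bounded shift of `B` changes a one-symbol probability by the order of the inverse square of
the size, one order below the probability itself. -/
theorem abs_symbolProb_sub_le {d : ℕ} {a B δ : ℝ} (ha : 0 ≤ a) {i m : ℕ} (him : i + d + 1 ≤ m)
    (hB : (m : ℝ) < B) (hδ : 0 ≤ δ) (hδd : δ ≤ d + 1) (hD : d + 2 ≤ B + δ) (x : ABSymbol) :
    |symbolProb d a B i (some x) - symbolProb d a (B + δ) i (some x)| ≤
      6 * (d + 2) ^ 3 / (B + a + 1) ^ 2 := by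
  obtain ⟨h1, h2⟩ := symbolProb_bounds ha him hB x
  have h3 : (i : ℝ) + d + 1 ≤ m := by exact_mod_cast him
  have hi : (0 : ℝ) ≤ i := by positivity
  have hd : (0 : ℝ) ≤ d := by positivity
  have hD0 : 0 < B + a - d - 1 := by linarith
  have h4 : |symbolNumerator a (B - (i + d) - 1) i x -
      symbolNumerator a (B + δ - (i + d) - 1) i x| ≤ δ := by
    rcases x with _ | _ <;> simp only [symbolNumerator]
    · rw [abs_le]; constructor <;> linarith
    · simpa using hδ
  have h5 := abs_div_sub_div_le hD0 hδ (by linarith) h1 h2 h4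
  have e1 : B + a - d - 1 + 1 = B + a - d := by ring
  have e2 : B + a - d - 1 + δ + 1 = B + δ + a - d := by ring
  have e3 : B + a - d - 1 + δ = B + δ + a - d - 1 := by ring
  rw [e2, e1, e3] at h5
  refine h5.trans ?_
  have h6 : B + a + 1 ≤ (d + 2) * (B + a - d) := by nlinarith
  have h7 : 0 < B + a - d := by linarith
  have h8 : 0 < B + a + 1 := by linarith
  rw [div_le_div_iff₀ (by positivity) (by positivity)]
  calc 6 * δ * (B + a + 1) ^ 2 ≤ 6 * (d + 2) * ((d + 2) * (B + a - d)) ^ 2 := by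
        gcongr; linarith
    _ = _ := by ring

/-- The factors are exchanged one at a time: each exchange costs `K / M ^ 2` instead of `K / M`. -/
theorem abs_prod_sub_prod_le {u v : ℕ → ℝ} {e : ℕ → Option ABSymbol} {K M : ℝ} (hK : 0 ≤ K)
    (hM : 0 < M) {R : ℕ} (hu : ∀ i < R, e i = none → u i = 1) (hv : ∀ i < R, e i = none → v i = 1)
    (hu' : ∀ i < R, e i ≠ none → |u i| ≤ K / M) (hv' : ∀ i < R, e i ≠ none → |v i| ≤ K / M)
    (huv : ∀ i < R, e i ≠ none → |u i - v i| ≤ K / M ^ 2) :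
    |∏ i ∈ Finset.range R, u i| * M ^ eventCount e R ≤ K ^ eventCount e R ∧
    |∏ i ∈ Finset.range R, u i - ∏ i ∈ Finset.range R, v i| * M ^ (eventCount e R + 1) ≤
      eventCount e R * K ^ eventCount e R := by
  induction R with
  | zero => simp [eventCount]
  | succ R ih =>
    obtain ⟨h1, h2⟩ := ih (fun i hi => hu i (by omega)) (fun i hi => hv i (by omega))
      (fun i hi => hu' i (by omega)) (fun i hi => hv' i (by omega)) fun i hi => huv i (by omega)
    rw [Finset.prod_range_succ, Finset.prod_range_succ, eventCount_succ]
    by_cases hR : e R = none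
    · rw [hu R (by omega) hR, hv R (by omega) hR, if_neg (by simpa using hR), mul_one, mul_one,
        add_zero]
      exact ⟨h1, h2⟩
    · rw [if_pos hR]
      have g1 := hu' R (by omega) hR
      have g2 := hv' R (by omega) hR
      have g3 := huv R (by omega) hR
      rw [le_div_iff₀ (by positivity)] at g1 g2 g3
      set U := ∏ i ∈ Finset.range R, u i
      set V := ∏ i ∈ Finset.range R, v i
      set c := eventCount e R
      constructor
      · calc |U * u R| * M ^ (c + 1) = (|U| * M ^ c) * (|u R| * M) := by rw [abs_mul]; ring
          _ ≤ K ^ c * K := by gcongr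
          _ = _ := by ring
      · have : U * u R - V * v R = U * (u R - v R) + (U - V) * v R := by ring
        rw [this]
        calc |U * (u R - v R) + (U - V) * v R| * M ^ (c + 1 + 1)
            ≤ (|U| * |u R - v R| + |U - V| * |v R|) * M ^ (c + 1 + 1) := by
              rw [← abs_mul, ← abs_mul]; gcongr; exact abs_add_le _ _
          _ = (|U| * M ^ c) * (|u R - v R| * M ^ 2) + (|U - V| * M ^ (c + 1)) * (|v R| * M) := by
              ring
          _ ≤ K ^ c * K + (c * K ^ c) * K := by gcongr
          _ = _ := by push_cast; ring

/-- The product of the asymptotic probabilities of the prescribed symbols in the first `R` rows. -/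
noncomputable def mainTerm (d : ℕ) (e : ℕ → Option ABSymbol) (a B : ℝ) (R : ℕ) : ℝ :=
  ∏ i ∈ Finset.range R, symbolProb d a B i (e i)

theorem mainTerm_eq_of_none {d : ℕ} {e : ℕ → Option ABSymbol} {a B : ℝ} {R R' : ℕ} (hR : R ≤ R')
    (he : ∀ l, R ≤ l → l < R' → e l = none) : mainTerm d e a B R' = mainTerm d e a B R := by
  refine (Finset.prod_subset (Finset.range_mono hR) fun l hl hl' => ?_).symm
  rw [he l (by simpa using hl') (by simpa using hl)]
  rfl

/-! ### Asymptotic independence of separated symbols -/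

theorem rowSum_sub_const_mul (d : ℕ) (b : ℝ) (R : ℕ) (o : Option ABSymbol) (G H : Finset ℕ → ℝ)
    (c : ℝ) : rowSum d b R o (fun Q => G Q - c * H Q) =
      fun Q => rowSum d b R o G Q - c * rowSum d b R o H Q := by
  funext Q
  rcases o with _ | _ | _
  · simp only [rowSum, mul_add, Finset.mul_sum]
    rw [add_sub_add_comm, ← Finset.sum_sub_distrib]
    congr 1
    exact Finset.sum_congr rfl fun A _ => by ring
  · simp only [rowSum, Finset.mul_sum]
    rw [← Finset.sum_sub_distrib]
    exact Finset.sum_congr rfl fun A _ => by split_ifs <;> ring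
  · simp only [rowSum]
    split_ifs
    · rw [Finset.mul_sum, ← Finset.sum_sub_distrib]
    · ring

/-- By `transfer_insert`, the values at `Q` are combinations of values at `∅` with parameters `b, …,
b + |Q|`, with the same coefficients for `e` and `e₀`. Each column costs `1 + 2 ^ s`: the `2 ^ s`
comes from the term with `b`, whose size is smaller by one. -/
theorem abs_transfer_sub_le_of_empty {d : ℕ} {e e₀ : ℕ → Option ABSymbol} {a : ℝ} {i s : ℕ}
    {μ H : ℝ} (he : ∀ l < i, e l ≠ none → l + d < i) (he₀ : ∀ l < i, e₀ l = none) (ha : 0 ≤ a)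
    (hH : 0 ≤ H) (Q : Finset ℕ) (b : ℝ) (hb : 0 ≤ b) (hQ : ∀ y ∈ Q, i ≤ y)
    (h : ∀ m ≤ Q.card, |transfer d e a (b + m) i ∅ - μ * risingProd a (b + m) i| *
      (i + a + (b + m) + 1) ^ s ≤ H * risingProd a (b + m) i) :
    |transfer d e a b i Q - μ * transfer d e₀ a b i Q| * (i + Q.card + a + b + 1) ^ s ≤
      (1 + 2 ^ s) ^ Q.card * H * risingProd a b (i + Q.card) := by
  induction Q using Finset.induction_on_max generalizing b with
  | empty =>
    rw [transfer_eq_of_none he₀ b (by simp)]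
    simpa using h 0 le_rfl
  | insert y Q hy ih =>
    have hyi := hQ y (Finset.mem_insert_self _ _)
    have hQ' : ∀ z ∈ Q, i ≤ z := fun z hz => hQ z (Finset.mem_insert_of_mem hz)
    have hcard : (insert y Q).card = Q.card + 1 :=
      Finset.card_insert_of_notMem fun h => lt_irrefl _ (hy y h)
    rw [hcard] at h ⊢
    have ih1 := ih (b + 1) (by positivity) hQ' fun m hm => by
      have := h (m + 1) (by omega)
      have e1 : b + (m + 1 : ℕ) = b + 1 + m := by push_cast; ring
      rwa [e1] at this
    have ih0 := ih b hb hQ' fun m hm => h m (by omega)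
    rw [transfer_insert hy hyi fun l hl hl' => ((he l hl hl').trans_le hyi).ne,
      transfer_insert hy hyi fun l hl hl' => absurd (he₀ l hl) hl']
    set X := transfer d e a (b + 1) i Q - μ * transfer d e₀ a (b + 1) i Q
    set Y := transfer d e a b i Q - μ * transfer d e₀ a b i Q
    set M : ℝ := i + Q.card + a + b + 1 with hM
    have hM1 : 1 ≤ M := by
      have : (0 : ℝ) ≤ i + Q.card := by positivity
      linarith
    have e2 : (i : ℝ) + (Q.card + 1 : ℕ) + a + b + 1 = M + 1 := by rw [hM]; push_cast; ring
    have e3 : (i : ℝ) + Q.card + a + (b + 1) + 1 = M + 1 := by rw [hM]; ring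
    have e4 : (a + b) * transfer d e a (b + 1) i Q - b * transfer d e a b i Q -
        μ * ((a + b) * transfer d e₀ a (b + 1) i Q - b * transfer d e₀ a b i Q) =
        (a + b) * X - b * Y := by ring
    rw [e2, e4]
    rw [e3] at ih1
    have hZ0 := risingProd_nonneg (a := a) (b := b) (by positivity) (i + Q.card)
    have hbZ : b * risingProd a b (i + Q.card) ≤ risingProd a b (i + Q.card + 1) := by
      rw [risingProd_succ, mul_comm]
      refine mul_le_mul_of_nonneg_left ?_ hZ0
      have : (0 : ℝ) ≤ (i + Q.card : ℕ) := by positivity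
      linarith
    calc |(a + b) * X - b * Y| * (M + 1) ^ s
        ≤ ((a + b) * |X| + b * |Y|) * (M + 1) ^ s := by
          gcongr
          refine (abs_sub _ _).trans (le_of_eq ?_)
          rw [abs_mul, abs_mul, abs_of_nonneg hb, abs_of_nonneg (by positivity : 0 ≤ a + b)]
      _ ≤ (a + b) * (|X| * (M + 1) ^ s) + b * |Y| * (2 * M) ^ s := by
          rw [add_mul, mul_assoc]; gcongr; linarith
      _ = (a + b) * (|X| * (M + 1) ^ s) + 2 ^ s * b * (|Y| * M ^ s) := by rw [mul_pow]; ring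
      _ ≤ (a + b) * ((1 + 2 ^ s) ^ Q.card * H * risingProd a (b + 1) (i + Q.card)) +
          2 ^ s * b * ((1 + 2 ^ s) ^ Q.card * H * risingProd a b (i + Q.card)) := by gcongr
      _ = (1 + 2 ^ s) ^ Q.card * H * risingProd a b (i + Q.card + 1) +
          2 ^ s * ((1 + 2 ^ s) ^ Q.card * H) * (b * risingProd a b (i + Q.card)) := by
          rw [risingProd_succ']; ring
      _ ≤ (1 + 2 ^ s) ^ Q.card * H * risingProd a b (i + Q.card + 1) +
          2 ^ s * ((1 + 2 ^ s) ^ Q.card * H) * risingProd a b (i + Q.card + 1) := by gcongr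
      _ = _ := by rw [pow_succ, ← add_assoc]; ring

/-- The main terms needed above row `i` have total `B = b + m + i` depending on the number `m` of
removed columns. Replacing them all by the single value at `B = b + i + d + 1` is a shift by `d + 1
- m`, of lower order. -/
theorem abs_mainTerm_sub_le {d : ℕ} {e : ℕ → Option ABSymbol} {a b : ℝ} (ha : 0 ≤ a) (hb : 0 < b)
    {i m : ℕ} (he : ∀ l < i, e l ≠ none → l + d < i) (hm : m ≤ d + 1) :
    |mainTerm d e a (b + m + i) i - mainTerm d e a (b + (i + d + 1 : ℕ)) i| *
        (i + a + (b + m) + 1) ^ (eventCount e i + 1) ≤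
      eventCount e i * (6 * (d + 2) ^ 3) ^ eventCount e i := by
  set B : ℝ := b + m + i with hB
  set M : ℝ := i + a + (b + m) + 1 with hM
  set δ : ℝ := d + 1 - m with hδ
  have hm' : (m : ℝ) ≤ d + 1 := by exact_mod_cast hm
  have hM0 : 0 < M := by positivity
  have hBi : (i : ℝ) < B := by
    have : (0 : ℝ) ≤ m := by positivity
    linarith
  have hMB : M = B + a + 1 := by rw [hM, hB]; ring
  have hBδ : b + (i + d + 1 : ℕ) = B + δ := by rw [hB, hδ]; push_cast; ring
  have hδ0 : 0 ≤ δ := by linarith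
  have hδd : δ ≤ d + 1 := by
    have : (0 : ℝ) ≤ m := by positivity
    linarith
  rw [hBδ]
  have hK : (d + 2 : ℝ) ≤ 6 * (d + 2) ^ 3 := by
    have : (0 : ℝ) ≤ d := by positivity
    have h1 : (1 : ℝ) ≤ (d + 2) ^ 2 := one_le_pow₀ (by linarith)
    nlinarith [mul_le_mul_of_nonneg_left h1 (show (0 : ℝ) ≤ d + 2 by positivity)]
  refine (abs_prod_sub_prod_le (e := e) (K := 6 * (d + 2) ^ 3) (M := M) (by positivity) hM0
    (fun l _ h => by rw [h]; rfl) (fun l _ h => by rw [h]; rfl) ?_ ?_ ?_).2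
  · intro l hl h
    obtain ⟨x, hx⟩ := Option.ne_none_iff_exists'.1 h
    rw [hx]
    exact (abs_symbolProb_le ha (he l hl h) hBi hM0 hMB.le x).trans (by gcongr)
  · intro l hl h
    obtain ⟨x, hx⟩ := Option.ne_none_iff_exists'.1 h
    rw [hx]
    exact (abs_symbolProb_le ha (he l hl h) (by linarith) hM0 (by linarith) x).trans (by gcongr)
  · intro l hl h
    obtain ⟨x, hx⟩ := Option.ne_none_iff_exists'.1 h
    rw [hx, hMB]
    refine abs_symbolProb_sub_le ha (he l hl h) hBi hδ0 hδd ?_ x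
    have hi : (1 : ℝ) ≤ i := by exact_mod_cast (show 1 ≤ i by omega)
    rw [← hBδ]
    push_cast
    linarith

theorem abs_transfer_sub_mainTerm_le {d : ℕ} (hd : 1 ≤ d) (r : ℕ) : ∃ C : ℝ, 0 ≤ C ∧
    ∀ (e : ℕ → Option ABSymbol) (a b : ℝ) (R : ℕ), 0 < a → 0 < b →
      (∀ i < R, e i ≠ none → i + d < R) →
      (∀ i i', i < i' → i' < R → e i ≠ none → e i' ≠ none → i + d < i') → eventCount e R = r →
      |transfer d e a b R ∅ - mainTerm d e a (b + R) R * risingProd a b R| *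
        (R + a + b + 1) ^ (r + 1) ≤ C * risingProd a b R := by
  induction r with
  | zero =>
    refine ⟨0, le_rfl, fun e a b R ha hb _ _ hr => ?_⟩
    have he := eq_none_of_eventCount_eq_zero hr
    rw [transfer_eq_of_none he b (by simp), mainTerm_eq_of_none (Nat.zero_le R) fun l _ hl => he l hl]
    simp [mainTerm]
  | succ r ihr =>
    obtain ⟨C, hC, ih⟩ := ihr
    set H : ℝ := C + r * (6 * (d + 2) ^ 3) ^ r with hH
    have hH0 : 0 ≤ H := by positivity
    set C' : ℝ := rowSumFactor d (r + 1) * ((1 + 2 ^ (r + 1)) ^ (d + 1) * H) with hC'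
    have hC'0 : 0 ≤ C' := mul_nonneg (rowSumFactor_nonneg _ _) (by positivity)
    refine ⟨C', hC'0, fun e a b R ha hb hR hsep hr => ?_⟩
    obtain ⟨i, x, hi, hx, hn, hc⟩ := exists_last_event hr
    have hxi : e i ≠ none := by simp [hx]
    have hiR := hR i hi hxi
    have hsep' : ∀ l < i, e l ≠ none → l + d < i := fun l hl hl' => hsep l i hl hi hl' hxi
    have near : ∀ b : ℝ, 0 < b → |transfer d e a b (i + d + 1) ∅ -
        mainTerm d e a (b + (i + d + 1 : ℕ)) (i + d + 1) * risingProd a b (i + d + 1)| *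
        ((i + d + 1 : ℕ) + a + b + 1) ^ (r + 1 + 1) ≤ C' * risingProd a b (i + d + 1) := by
      intro b hb
      -- `μ` is the main term of all symbols but the last, taken at the `B` of the whole filling so
      -- that it does not depend on `Q`; `e₁` keeps only the last symbol.
      set μ := mainTerm d e a (b + (i + d + 1 : ℕ)) i with hμ
      set e₁ : ℕ → Option ABSymbol := fun l => if l = i then e i else none with he₁
      have h₁ : ∀ l, l ≠ i → e₁ l = none := fun l hl => if_neg hl
      have h₁i : e₁ i = some x := by rw [← hx]; exact if_pos rfl
      have hmain : mainTerm d e a (b + (i + d + 1 : ℕ)) (i + d + 1) =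
          μ * symbolProb d a (b + (i + d + 1 : ℕ)) i (some x) := by
        rw [mainTerm_eq_of_none (R := i + 1) (by omega) fun l hl hl' => hn l hl (by omega),
          mainTerm, Finset.prod_range_succ, hx, hμ, mainTerm]
      rw [hmain, mul_assoc, ← transfer_single hd ha hb h₁i (by omega) fun l _ hl => h₁ l hl]
      -- The difference of the true count and `μ` times the one-symbol count obeys the same
      -- recursion from row `i` on, by linearity. It is already smaller by `r + 1` powers above row
      -- `i`, and row `i` gains the last one.
      have := abs_le_of_rowSum (d := d) (s := r + 1) (t := d) (i := i) (x := x) ha.le hb.le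
        (F := fun R Q => transfer d e a b R Q - μ * transfer d e₁ a b R Q)
        (C := (1 + 2 ^ (r + 1)) ^ (d + 1) * H) (by positivity)
        (by
          rw [rowSum_sub_const_mul]
          simp only [transfer_succ, hx, h₁i])
        (fun l hl hl' => by
          rw [rowSum_sub_const_mul]
          simp only [transfer_succ, hn l hl (by omega), h₁ l (by omega)])
        (fun Q hQd hQ => by
          refine (abs_transfer_sub_le_of_empty hsep' (fun l hl => h₁ l hl.ne) ha.le hH0 Q b hb.le
            hQ fun m hm => ?_).trans ?_
          · have hbm : 0 < b + m := by positivity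
            have h1 := ih e a (b + m) i ha hbm hsep' (fun l l' hl hl' =>
              hsep l l' hl (by omega)) hc
            have h2 := abs_mainTerm_sub_le (d := d) (e := e) ha.le hb hsep' (hm.trans hQd)
            rw [hc, ← hμ] at h2
            have hZ := risingProd_nonneg (a := a) (b := b + m) (by positivity) i
            have hM : 0 ≤ (i : ℝ) + a + (b + m) + 1 := by positivity
            set T := transfer d e a (b + m) i ∅
            set μ' := mainTerm d e a (b + m + i) i
            set Z := risingProd a (b + m) i
            calc |T - μ * Z| * (i + a + (b + m) + 1) ^ (r + 1)
                = |(T - μ' * Z) + (μ' - μ) * Z| * (i + a + (b + m) + 1) ^ (r + 1) := by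
                  congr 2; ring
              _ ≤ (|T - μ' * Z| + |μ' - μ| * Z) * (i + a + (b + m) + 1) ^ (r + 1) := by
                  gcongr
                  refine (abs_add_le _ _).trans (le_of_eq ?_)
                  rw [abs_mul (μ' - μ), abs_of_nonneg hZ]
              _ = |T - μ' * Z| * (i + a + (b + m) + 1) ^ (r + 1) +
                  |μ' - μ| * (i + a + (b + m) + 1) ^ (r + 1) * Z := by ring
              _ ≤ C * Z + r * (6 * (d + 2) ^ 3) ^ r * Z := by gcongr
              _ = H * Z := by rw [hH]; ring
          · have hZ := risingProd_nonneg (a := a) (b := b) (by positivity) (i + Q.card)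
            have h2 : (0 : ℝ) ≤ 2 ^ (r + 1) := by positivity
            gcongr
            linarith)
        (Q := ∅) (by simp) (by simp)
      rw [show i + 1 + d = i + d + 1 by ring, ← mul_assoc] at this
      simpa [hC', mul_assoc] using this
    -- The remaining `m` leftmost columns are removed exactly; neither `B` nor the size plus `b`
    -- changes.
    obtain ⟨m, rfl⟩ := Nat.exists_eq_add_of_lt hiR
    rw [show i + d + m + 1 = i + d + 1 + m by ring] at *
    have h1 := near (b + m) (by positivity)
    have h2 := transfer_add_empty (d := d) (e := e) (a := a) (R := i + d + 1) m b (by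
      intro l hl hl'
      have : l ≤ i := by
        by_contra hli
        exact hl' (hn l (by omega) hl)
      omega)
    rw [mainTerm_eq_of_none (R := i + d + 1) (by omega) fun l hl hl' => hn l (by omega) hl']
    have e1 : b + (i + d + 1 + m : ℕ) = b + m + (i + d + 1 : ℕ) := by push_cast; ring
    have e2 : ((i + d + 1 + m : ℕ) : ℝ) + a + b + 1 = (i + d + 1 : ℕ) + a + (b + m) + 1 := by
      push_cast; ring
    rw [e1, e2]
    have hp := risingProd_pos (a := a) (b := b + m) (by positivity) (i + d + 1)
    have hp' := risingProd_pos (a := a) (b := b) (by positivity) (i + d + 1 + m)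
    set Z := risingProd a (b + m) (i + d + 1)
    set Z' := risingProd a b (i + d + 1 + m)
    set T := transfer d e a (b + m) (i + d + 1) ∅
    set μ := mainTerm d e a (b + m + (i + d + 1 : ℕ)) (i + d + 1)
    refine le_of_mul_le_mul_right ?_ hp
    calc _ = |(transfer d e a b (i + d + 1 + m) ∅ - μ * Z') * Z| *
          ((i + d + 1 : ℕ) + a + (b + m) + 1) ^ (r + 1 + 1) := by
          rw [abs_mul, abs_of_pos hp]; ring
      _ = |(T - μ * Z) * Z'| * ((i + d + 1 : ℕ) + a + (b + m) + 1) ^ (r + 1 + 1) := by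
          congr 2; linear_combination h2
      _ = Z' * (|T - μ * Z| * ((i + d + 1 : ℕ) + a + (b + m) + 1) ^ (r + 1 + 1)) := by
          rw [abs_mul, abs_of_pos hp']; ring
      _ ≤ Z' * (C' * Z) := by gcongr
      _ = _ := by ring

/-! ### Enumeration of the admissible rows -/

/-- The row with `α` in the columns `A` and, possibly, `β` in the column `o`. -/
def mkRow {n : ℕ} (A : Finset ℕ) (o : Option ℕ) (c : Fin n) : Option ABSymbol :=
  if (c : ℕ) ∈ A then some ABSymbol.alpha else if o = some (c : ℕ) then some ABSymbol.beta else none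

theorem mkRow_eq_alpha {n : ℕ} {A : Finset ℕ} {o : Option ℕ} {c : Fin n} :
    mkRow A o c = some ABSymbol.alpha ↔ (c : ℕ) ∈ A := by
  unfold mkRow
  split_ifs <;> simp_all

theorem mkRow_eq_beta {n : ℕ} {A : Finset ℕ} {o : Option ℕ} {c : Fin n} :
    mkRow A o c = some ABSymbol.beta ↔ (c : ℕ) ∉ A ∧ o = some (c : ℕ) := by
  unfold mkRow
  split_ifs <;> simp_all

theorem mkRow_eq_none {n : ℕ} {A : Finset ℕ} {o : Option ℕ} {c : Fin n} :
    mkRow A o c = none ↔ (c : ℕ) ∉ A ∧ o ≠ some (c : ℕ) := by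
  unfold mkRow
  split_ifs <;> simp_all

/-- `ρ` is an admissible row `R` if `Q` is the set of free columns to the left of column `R`. -/
structure IsRow {n : ℕ} (R : ℕ) (Q : Finset ℕ) (ρ : Fin n → Option ABSymbol) : Prop where
  support : ∀ c, ρ c ≠ none → (c : ℕ) = R ∨ (c : ℕ) ∈ Q
  diagonal : ∀ c : Fin n, R = (c : ℕ) → ρ c ≠ none
  west : ∀ c, ρ c = some ABSymbol.beta → ∀ c', c < c' → ρ c' = none

/-- The row `ρ` has the symbol prescribed by `o` in column `m`. -/
def RowMatches {n : ℕ} (m : ℕ) (o : Option ABSymbol) (ρ : Fin n → Option ABSymbol) : Prop :=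
  ∀ x, o = some x → ∃ c : Fin n, (c : ℕ) = m ∧ ρ c = some x

/-- The columns of the `α`s in the row `ρ`. -/
def alphaSet {n : ℕ} (ρ : Fin n → Option ABSymbol) : Finset ℕ :=
  (Finset.univ.filter fun c => ρ c = some ABSymbol.alpha).map Fin.valEmbedding

theorem mem_alphaSet {n : ℕ} {ρ : Fin n → Option ABSymbol} {c : Fin n} :
    (c : ℕ) ∈ alphaSet ρ ↔ ρ c = some ABSymbol.alpha := by
  simp [alphaSet, Fin.val_inj]

theorem alphaSet_mkRow {n : ℕ} {A : Finset ℕ} (hA : ∀ y ∈ A, y < n) (o : Option ℕ) :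
    alphaSet (mkRow A o : Fin n → Option ABSymbol) = A := by
  ext y
  simp only [alphaSet, Finset.mem_map, Finset.mem_filter, Finset.mem_univ, true_and, mkRow_eq_alpha,
    Fin.valEmbedding_apply]
  exact ⟨by rintro ⟨c, h, rfl⟩; exact h, fun h => ⟨⟨y, hA y h⟩, h, rfl⟩⟩

theorem isRow_mkRow_singleton {n R : ℕ} {Q : Finset ℕ} :
    IsRow R Q (mkRow ∅ (some R) : Fin n → Option ABSymbol) where
  support c hc := by
    simp only [ne_eq, mkRow_eq_none] at hc
    simp at hc
    exact Or.inl hc.symm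
  diagonal c hc := by simp [mkRow_eq_none, hc]
  west c hc c' hcc := by
    simp only [mkRow_eq_beta, mkRow_eq_none, Option.some.injEq] at hc ⊢
    have : (c : ℕ) < c' := hcc
    simp
    omega

theorem isRow_mkRow_insert {n R : ℕ} {Q A : Finset ℕ} (hQ : ∀ y ∈ Q, R < y) (hA : A ⊆ Q)
    {o : Option ℕ} (ho : o ∈ Finset.insertNone (Q.filter fun c => ∀ x ∈ A, x < c)) :
    IsRow R Q (mkRow (insert R A) o : Fin n → Option ABSymbol) := by
  rw [Finset.mem_insertNone] at ho
  refine ⟨fun c hc => ?_, fun c hc => ?_, fun c hc c' hcc => ?_⟩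
  · simp only [ne_eq, mkRow_eq_none, not_and_or, not_not, Finset.mem_insert] at hc
    rcases hc with (hc | hc) | hc
    · exact Or.inl hc
    · exact Or.inr (hA hc)
    · exact Or.inr (Finset.mem_filter.1 (ho _ hc)).1
  · simp [mkRow_eq_none, ← hc]
  · rw [mkRow_eq_beta] at hc
    obtain ⟨h1, h2⟩ := Finset.mem_filter.1 (ho _ hc.2)
    have hcc' : (c : ℕ) < c' := hcc
    rw [mkRow_eq_none, Finset.mem_insert, hc.2, ne_eq, Option.some.injEq]
    refine ⟨?_, hcc'.ne⟩
    rintro (h | h)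
    · have := hQ _ h1; omega
    · have := h2 _ h; omega

theorem IsRow.eq_mkRow_singleton {n R : ℕ} {Q : Finset ℕ} (hQ : ∀ y ∈ Q, R < y)
    {ρ : Fin n → Option ABSymbol} (h : IsRow R Q ρ) (hR : R < n)
    (hβ : ρ ⟨R, hR⟩ = some ABSymbol.beta) : ρ = mkRow ∅ (some R) := by
  funext c
  rcases lt_trichotomy R c with hc | hc | hc
  · rw [h.west _ hβ c hc, eq_comm, mkRow_eq_none]
    simp [hc.ne]
  · obtain rfl : c = ⟨R, hR⟩ := Fin.ext hc.symm
    rw [hβ, eq_comm, mkRow_eq_beta]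
    simp
  · have : ρ c = none := by
      by_contra hne
      rcases h.support c hne with h1 | h1
      · omega
      · have := hQ _ h1; omega
    rw [this, eq_comm, mkRow_eq_none]
    simp
    omega

theorem IsRow.exists_eq_mkRow_insert {n R : ℕ} {Q : Finset ℕ} {ρ : Fin n → Option ABSymbol}
    (h : IsRow R Q ρ) (hR : R < n) (hα : ρ ⟨R, hR⟩ = some ABSymbol.alpha) :
    ∃ A ⊆ Q, ∃ o ∈ Finset.insertNone (Q.filter fun c => ∀ x ∈ A, x < c),
      mkRow (insert R A) o = ρ := by
  have hA : ∀ c : Fin n, (c : ℕ) ∈ insert R ((alphaSet ρ).filter (· ∈ Q)) ↔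
      ρ c = some ABSymbol.alpha := by
    intro c
    rw [Finset.mem_insert, Finset.mem_filter, mem_alphaSet]
    constructor
    · rintro (hc | hc)
      · obtain rfl : c = ⟨R, hR⟩ := Fin.ext hc
        exact hα
      · exact hc.1
    · intro hc
      rcases h.support c (by simp [hc]) with h1 | h1
      exacts [Or.inl h1, Or.inr ⟨hc, h1⟩]
  refine ⟨(alphaSet ρ).filter (· ∈ Q), fun y hy => (Finset.mem_filter.1 hy).2, ?_⟩
  by_cases hβ : ∃ c, ρ c = some ABSymbol.beta
  · obtain ⟨c, hc⟩ := hβ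
    have huniq : ∀ c', ρ c' = some ABSymbol.beta → c' = c := by
      intro c' hc'
      rcases lt_trichotomy c' c with hlt | heq | hlt
      · have := h.west c' hc' c hlt; simp [hc] at this
      · exact heq
      · have := h.west c hc c' hlt; simp [hc'] at this
    refine ⟨some (c : ℕ), ?_, ?_⟩
    · rw [Finset.some_mem_insertNone, Finset.mem_filter]
      constructor
      · rcases h.support c (by simp [hc]) with h1 | h1
        · obtain rfl : c = ⟨R, hR⟩ := Fin.ext h1
          simp [hα] at hc
        · exact h1
      · intro y hy
        obtain ⟨c', hc', rfl⟩ := Finset.mem_map.1 (Finset.mem_filter.1 hy).1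
        have hc'' := (Finset.mem_filter.1 hc').2
        by_contra hlt
        rcases (not_lt.1 hlt).lt_or_eq with hlt | heq
        · have := h.west c hc c' hlt; simp [hc''] at this
        · have : c = c' := Fin.ext heq
          simp [← this, hc] at hc''
    · funext c'
      rcases h' : ρ c' with _ | _ | _
      · rw [mkRow_eq_none, hA]
        refine ⟨by simp [h'], fun heq => ?_⟩
        obtain rfl : c = c' := Fin.ext (Option.some.inj heq)
        simp [hc] at h'
      · rw [mkRow_eq_alpha, hA, h']
      · rw [mkRow_eq_beta, hA, huniq c' h']
        simp [hc]
  · refine ⟨none, by simp, ?_⟩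
    funext c'
    rcases h' : ρ c' with _ | _ | _
    · rw [mkRow_eq_none, hA]
      simp [h']
    · rw [mkRow_eq_alpha, hA, h']
    · exact absurd ⟨c', h'⟩ hβ

-- A `β` must be the leftmost symbol of its row. So a row with `β` in the corner is otherwise empty,
-- and any other row is given by its set of `α`s and an optional `β` to the left of them all.
open Classical in
theorem sum_isRow {n R : ℕ} {Q : Finset ℕ} (hR : R < n) (hQ : ∀ y ∈ Q, R < y ∧ y < n)
    (f : (Fin n → Option ABSymbol) → ℝ) :
    ∑ ρ with IsRow R Q ρ, f ρ = f (mkRow ∅ (some R)) +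
      ∑ A ∈ Q.powerset, (f (mkRow (insert R A) none) +
        ∑ c ∈ Q with ∀ x ∈ A, x < c, f (mkRow (insert R A) (some c))) := by
  have hQ1 : ∀ y ∈ Q, R < y := fun y hy => (hQ y hy).1
  have hRQ : R ∉ Q := fun h => lt_irrefl _ (hQ1 R h)
  rw [← Finset.sum_filter_add_sum_filter_not _ (fun ρ => ρ ⟨R, hR⟩ = some ABSymbol.beta)]
  congr 1
  · have : (Finset.univ.filter fun ρ : Fin n → Option ABSymbol => IsRow R Q ρ).filter
        (fun ρ => ρ ⟨R, hR⟩ = some ABSymbol.beta) = {mkRow ∅ (some R)} := by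
      ext ρ
      simp only [Finset.mem_filter, Finset.mem_univ, true_and, Finset.mem_singleton]
      constructor
      · exact fun h => h.1.eq_mkRow_singleton hQ1 hR h.2
      · rintro rfl
        exact ⟨isRow_mkRow_singleton, by simp [mkRow_eq_beta]⟩
    rw [this, Finset.sum_singleton]
  · have h1 : ∀ A ∈ Q.powerset, (f (mkRow (insert R A) none) +
        ∑ c ∈ Q with ∀ x ∈ A, x < c, f (mkRow (insert R A) (some c))) =
        ∑ o ∈ Finset.insertNone (Q.filter fun c => ∀ x ∈ A, x < c), f (mkRow (insert R A) o) :=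
      fun A _ => by rw [Finset.sum_insertNone]
    rw [Finset.sum_congr rfl h1, Finset.sum_sigma']
    symm
    refine Finset.sum_nbij (fun p => mkRow (insert R p.1) p.2) ?_ ?_ ?_ fun _ _ => rfl
    · rintro ⟨A, o⟩ hp
      simp only [Finset.mem_sigma, Finset.mem_powerset] at hp
      simp only [Finset.mem_filter, Finset.mem_univ, true_and]
      refine ⟨isRow_mkRow_insert hQ1 hp.1 hp.2, ?_⟩
      rw [mkRow_eq_beta]
      simp
    · rintro ⟨A, o⟩ hp ⟨A', o'⟩ hp' heq
      simp only [Finset.coe_sigma, Set.mem_sigma_iff, Finset.mem_coe, Finset.mem_powerset] at hp hp'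
      simp only at heq
      have hlt : ∀ A ⊆ Q, ∀ y ∈ insert R A, y < n := by
        intro A hA y hy
        rcases Finset.mem_insert.1 hy with rfl | hy
        exacts [hR, (hQ y (hA hy)).2]
      have hAA : A = A' := by
        have h2 := congrArg alphaSet heq
        rw [alphaSet_mkRow (hlt A hp.1), alphaSet_mkRow (hlt A' hp'.1)] at h2
        rw [← Finset.erase_insert (fun h => hRQ (hp.1 h)), h2,
          Finset.erase_insert (fun h => hRQ (hp'.1 h))]
      subst hAA
      have hoo : ∀ o ∈ Finset.insertNone (Q.filter fun c => ∀ x ∈ A, x < c),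
          ∀ o' ∈ Finset.insertNone (Q.filter fun c => ∀ x ∈ A, x < c),
          (mkRow (insert R A) o : Fin n → Option ABSymbol) = mkRow (insert R A) o' →
          ∀ c, o = some c → o' = some c := by
        rintro o ho o' - heq c rfl
        rw [Finset.some_mem_insertNone, Finset.mem_filter] at ho
        have hcn := (hQ c ho.1).2
        have h3 : (mkRow (insert R A) (some c) : Fin n → Option ABSymbol) ⟨c, hcn⟩ =
            some ABSymbol.beta := by
          rw [mkRow_eq_beta, Finset.mem_insert, not_or]
          exact ⟨⟨(hQ1 c ho.1).ne', fun h => lt_irrefl _ (ho.2 c h)⟩, rfl⟩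
        rw [heq, mkRow_eq_beta] at h3
        exact h3.2
      have : o = o' := Option.ext fun c =>
        ⟨hoo o hp.2 o' hp'.2 heq c, hoo o' hp'.2 o hp.2 heq.symm c⟩
      rw [this]
    · intro ρ hρ
      simp only [Finset.coe_filter, Finset.mem_filter, Finset.mem_univ, true_and,
        Set.mem_ofPred_eq] at hρ
      have hα : ρ ⟨R, hR⟩ = some ABSymbol.alpha := by
        have h2 := hρ.1.diagonal ⟨R, hR⟩ rfl
        rcases h3 : ρ ⟨R, hR⟩ with _ | _ | _
        exacts [absurd h3 h2, rfl, absurd h3 hρ.2]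
      obtain ⟨A, hA, o, ho, rfl⟩ := hρ.1.exists_eq_mkRow_insert hR hα
      exact ⟨⟨A, o⟩, by simpa [Finset.mem_sigma] using ⟨hA, by simpa using ho⟩, rfl⟩

-- Here the weight of a row appears: each `A` has one row without `β`, of weight `b`, and `leftCount
-- Q A` rows with one. The columns with `α` are closed for the rows above. As `d ≥ 1`, the
-- prescribed box is never the corner.
open Classical in
theorem sum_isRow_matches {n R d : ℕ} (hd : 1 ≤ d) {Q : Finset ℕ} (hR : R < n)
    (hQ : ∀ y ∈ Q, R < y ∧ y < n) (b : ℝ) (o : Option ABSymbol) (G : Finset ℕ → ℝ) :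
    ∑ ρ : Fin n → Option ABSymbol with IsRow R Q ρ, (if RowMatches (R + d) o ρ then
      (if ∀ c, ρ c ≠ some ABSymbol.beta then b else 1) * G (insert R Q \ alphaSet ρ) else 0) =
      rowSum d b R o G Q := by
  have hQ1 : ∀ y ∈ Q, R < y := fun y hy => (hQ y hy).1
  have hRQ : R ∉ Q := fun h => lt_irrefl _ (hQ1 R h)
  rw [sum_isRow hR hQ]
  have hsing : (if ∀ c : Fin n, mkRow ∅ (some R) c ≠ some ABSymbol.beta then b else 1) *
      G (insert R Q \ alphaSet (mkRow ∅ (some R) : Fin n → Option ABSymbol)) = G (insert R Q) := by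
    rw [alphaSet_mkRow (by simp), if_neg, one_mul, Finset.sdiff_empty]
    exact fun h => h ⟨R, hR⟩ (by simp [mkRow_eq_beta])
  have hlt : ∀ A ⊆ Q, ∀ y ∈ insert R A, y < n := by
    intro A hA y hy
    rcases Finset.mem_insert.1 hy with rfl | hy
    exacts [hR, (hQ y (hA hy)).2]
  have hsd : ∀ A ⊆ Q, ∀ o, insert R Q \ alphaSet (mkRow (insert R A) o : Fin n → Option ABSymbol) =
      Q \ A := by
    intro A hA o
    rw [alphaSet_mkRow (hlt A hA), Finset.insert_sdiff_insert, Finset.sdiff_insert,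
      Finset.erase_eq_of_notMem fun h => hRQ (Finset.mem_sdiff.1 h).1]
  have hnone : ∀ A : Finset ℕ, (if ∀ c : Fin n, mkRow (insert R A) none c ≠ some ABSymbol.beta
      then b else 1) = b := fun A => if_pos fun c h => by
    rw [mkRow_eq_beta] at h
    simp at h
  have hsome : ∀ A : Finset ℕ, ∀ c ∈ Q.filter (fun c => ∀ x ∈ A, x < c),
      (if ∀ c' : Fin n, mkRow (insert R A) (some c) c' ≠ some ABSymbol.beta then b else 1) = 1 := by
    intro A c hc
    rw [Finset.mem_filter] at hc
    refine if_neg fun h => h ⟨c, (hQ c hc.1).2⟩ ?_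
    rw [mkRow_eq_beta, Finset.mem_insert, not_or]
    exact ⟨⟨(hQ1 c hc.1).ne', fun h => lt_irrefl _ (hc.2 c h)⟩, rfl⟩
  rcases o with _ | _ | _
  · have hm : ∀ ρ : Fin n → Option ABSymbol, RowMatches (R + d) none ρ := fun ρ x hx => by simp at hx
    simp only [hm, if_true, rowSum]
    rw [hsing]
    congr 1
    refine Finset.sum_congr rfl fun A hA => ?_
    have hAQ := Finset.mem_powerset.1 hA
    rw [hnone, hsd A hAQ, Finset.sum_congr rfl fun c hc => by rw [hsome A c hc, hsd A hAQ, one_mul],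
      Finset.sum_const, nsmul_eq_mul, leftCount]
    ring
  · have hm : ∀ (A : Finset ℕ) (o : Option ℕ), (∀ y ∈ A, y < n) →
        (RowMatches (R + d) (some ABSymbol.alpha) (mkRow A o : Fin n → Option ABSymbol) ↔
          R + d ∈ A) := by
      intro A o hA
      constructor
      · intro h
        obtain ⟨c, hc, hc'⟩ := h _ rfl
        rwa [mkRow_eq_alpha, hc] at hc'
      · intro h x hx
        obtain rfl := Option.some.inj hx
        exact ⟨⟨R + d, hA _ h⟩, rfl, mkRow_eq_alpha.2 h⟩
    rw [if_neg ((hm _ _ (by simp)).not.2 (by simp)), zero_add]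
    simp only [rowSum]
    refine Finset.sum_congr rfl fun A hA => ?_
    have hAQ := Finset.mem_powerset.1 hA
    simp only [hm (insert R A) _ (hlt A hAQ), hnone, hsd A hAQ]
    rw [Finset.sum_congr rfl fun c hc => by rw [hsome A c hc, one_mul]]
    have : R + d ∈ insert R A ↔ R + d ∈ A := by
      rw [Finset.mem_insert]
      exact ⟨fun h => h.resolve_left (by omega), Or.inr⟩
    simp only [this]
    split_ifs
    · rw [Finset.sum_const, nsmul_eq_mul, leftCount]
      ring
    · simp
  · have hm : ∀ (A : Finset ℕ) (o : Option ℕ),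
        (RowMatches (R + d) (some ABSymbol.beta) (mkRow A o : Fin n → Option ABSymbol) ↔
          R + d < n ∧ R + d ∉ A ∧ o = some (R + d)) := by
      intro A o
      constructor
      · intro h
        obtain ⟨c, hc, hc'⟩ := h _ rfl
        rw [mkRow_eq_beta, hc] at hc'
        exact ⟨hc ▸ c.2, hc'⟩
      · rintro ⟨h, h'⟩ x hx
        obtain rfl := Option.some.inj hx
        exact ⟨⟨R + d, h⟩, rfl, mkRow_eq_beta.2 h'⟩
    simp only [hm]
    rw [if_neg (by simp; omega), zero_add]
    simp only [rowSum]
    have hin : ∀ A ∈ Q.powerset, ((if R + d < n ∧ R + d ∉ insert R A ∧ none = some (R + d) then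
        (if ∀ c : Fin n, mkRow (insert R A) none c ≠ some ABSymbol.beta then b else 1) *
          G (insert R Q \ alphaSet (mkRow (insert R A) none : Fin n → Option ABSymbol)) else 0) +
        ∑ c ∈ Q with ∀ x ∈ A, x < c,
          if R + d < n ∧ R + d ∉ insert R A ∧ some c = some (R + d) then
          (if ∀ c' : Fin n, mkRow (insert R A) (some c) c' ≠ some ABSymbol.beta then b else 1) *
          G (insert R Q \ alphaSet (mkRow (insert R A) (some c) : Fin n → Option ABSymbol)) else 0) =
        if R + d ∈ Q ∧ ∀ x ∈ A, x < R + d then G (Q \ A) else 0 := by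
      intro A hA
      have hAQ := Finset.mem_powerset.1 hA
      rw [if_neg (by simp), zero_add]
      rw [Finset.sum_congr rfl (g := fun c => if R + d = c then G (Q \ A) else 0)]
      · rw [Finset.sum_ite_eq]
        simp only [Finset.mem_filter]
      · intro c hc
        rw [hsome A c hc, hsd A hAQ, one_mul]
        rw [Finset.mem_filter] at hc
        refine if_congr ⟨fun h => (Option.some.inj h.2.2).symm, ?_⟩ rfl rfl
        rintro rfl
        refine ⟨(hQ _ hc.1).2, ?_, rfl⟩
        rw [Finset.mem_insert, not_or]
        exact ⟨by omega, fun h => lt_irrefl _ (hc.2 _ h)⟩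
    rw [Finset.sum_congr rfl hin]
    split_ifs with hmem
    · rw [← Finset.sum_filter]
      refine Finset.sum_congr ?_ fun _ _ => rfl
      ext A
      simp only [Finset.mem_filter, Finset.mem_powerset, hmem, true_and, Finset.subset_iff]
      exact ⟨fun h y hy => ⟨h.1 hy, h.2 y hy⟩, fun h => ⟨fun y hy => (h hy).1, fun y hy => (h hy).2⟩⟩
    · exact Finset.sum_eq_zero fun A _ => if_neg fun h => hmem h.1

/-! ### Fillings counted by the transfer recursion -/

/-- A filling of the top `R` rows whose columns are those with index less than `R` and those in
`Q`. Columns are labelled from the right, so that column `c` ends in row `c`. -/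
structure IsPartial {n : ℕ} (R : ℕ) (Q : Finset ℕ) (T : Fin R → Fin n → Option ABSymbol) :
    Prop where
  support : ∀ (i : Fin R) (c : Fin n), T i c ≠ none → (i : ℕ) ≤ c ∧ ((c : ℕ) < R ∨ (c : ℕ) ∈ Q)
  diagonal : ∀ (i : Fin R) (c : Fin n), (i : ℕ) = c → T i c ≠ none
  north : ∀ i c, T i c = some ABSymbol.alpha → ∀ i', i' < i → T i' c = none
  west : ∀ i c, T i c = some ABSymbol.beta → ∀ c', c < c' → T i c' = none

/-- `T` contains the symbols prescribed by `e`. -/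
def Matches {n R : ℕ} (d : ℕ) (e : ℕ → Option ABSymbol) (T : Fin R → Fin n → Option ABSymbol) :
    Prop :=
  ∀ i : Fin R, RowMatches ((i : ℕ) + d) (e i) (T i)

open Classical in
/-- The columns without `α`. -/
noncomputable def freeColumns {n : ℕ} (R : ℕ) (Q : Finset ℕ) (T : Fin R → Fin n → Option ABSymbol) :
    Finset (Fin n) :=
  Finset.univ.filter fun c => ((c : ℕ) < R ∨ (c : ℕ) ∈ Q) ∧ ∀ i, T i c ≠ some ABSymbol.alpha

open Classical in
/-- The rows without `β`. -/
noncomputable def freeRows {n R : ℕ} (T : Fin R → Fin n → Option ABSymbol) : Finset (Fin R) :=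
  Finset.univ.filter fun i => ∀ c, T i c ≠ some ABSymbol.beta

/-- The last row affects the rows above only through its `α`s, by the column rule; deleting their
columns from the available ones encodes this completely. -/
theorem isPartial_snoc {n R : ℕ} {Q : Finset ℕ} (hQ : ∀ y ∈ Q, R < y)
    (T : Fin R → Fin n → Option ABSymbol) (ρ : Fin n → Option ABSymbol) :
    IsPartial (R + 1) Q (Fin.snoc (α := fun _ => Fin n → Option ABSymbol) T ρ) ↔
      IsRow R Q ρ ∧ IsPartial R (insert R Q \ alphaSet ρ) T := by
  constructor
  · intro h
    have hl : ∀ i c, T i c = (Fin.snoc (α := fun _ => Fin n → Option ABSymbol) T ρ :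
        Fin (R + 1) → Fin n → Option ABSymbol) i.castSucc c := fun i c => by rw [Fin.snoc_castSucc]
    have hr : ∀ c, ρ c = (Fin.snoc (α := fun _ => Fin n → Option ABSymbol) T ρ :
        Fin (R + 1) → Fin n → Option ABSymbol) (Fin.last R) c := fun c => by rw [Fin.snoc_last]
    refine ⟨⟨fun c hc => ?_, fun c hc => ?_, fun c hc c' hcc => ?_⟩,
      ⟨fun i c hc => ?_, fun i c hc => ?_, fun i c hc i' hi => ?_, fun i c hc c' hcc => ?_⟩⟩
    · rw [hr] at hc
      obtain ⟨h1, h2⟩ := h.support _ _ hc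
      rw [Fin.val_last] at h1
      rcases h2 with h2 | h2
      exacts [Or.inl (by omega), Or.inr h2]
    · rw [hr]; exact h.diagonal _ _ (by simpa using hc)
    · rw [hr] at hc ⊢; exact h.west _ _ hc _ hcc
    · have hc' := hc
      rw [hl] at hc
      obtain ⟨h1, h2⟩ := h.support _ _ hc
      refine ⟨by simpa using h1, ?_⟩
      have h3 : (c : ℕ) ∉ alphaSet ρ := by
        rw [mem_alphaSet, hr]
        exact fun h4 => hc (h.north _ _ h4 _ (Fin.castSucc_lt_last i))
      rw [Finset.mem_sdiff, Finset.mem_insert]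
      rcases h2 with h2 | h2
      · rcases Nat.lt_succ_iff_lt_or_eq.1 h2 with h2 | h2
        exacts [Or.inl h2, Or.inr ⟨Or.inl h2, h3⟩]
      · exact Or.inr ⟨Or.inr h2, h3⟩
    · rw [hl]; exact h.diagonal _ _ (by simpa using hc)
    · rw [hl] at hc ⊢; exact h.north _ _ hc _ (by simpa using hi)
    · rw [hl] at hc ⊢; exact h.west _ _ hc _ hcc
  · rintro ⟨hρ, hT⟩
    constructor
    · intro i
      refine Fin.lastCases ?_ (fun i => ?_) i
      · intro c hc
        rw [Fin.snoc_last] at hc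
        rw [Fin.val_last]
        rcases hρ.support c hc with h | h
        · exact ⟨h.ge, Or.inl (by omega)⟩
        · exact ⟨(hQ _ h).le, Or.inr h⟩
      · intro c hc
        rw [Fin.snoc_castSucc] at hc
        obtain ⟨h1, h2⟩ := hT.support i c hc
        refine ⟨by simpa using h1, ?_⟩
        rw [Finset.mem_sdiff, Finset.mem_insert] at h2
        rcases h2 with h2 | ⟨h2 | h2, -⟩
        exacts [Or.inl (by omega), Or.inl (by omega), Or.inr h2]
    · intro i
      refine Fin.lastCases ?_ (fun i => ?_) i
      · intro c hc
        rw [Fin.snoc_last]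
        exact hρ.diagonal c (by simpa using hc)
      · intro c hc
        rw [Fin.snoc_castSucc]
        exact hT.diagonal i c (by simpa using hc)
    · intro i
      refine Fin.lastCases ?_ (fun i => ?_) i
      · intro c hc i'
        rw [Fin.snoc_last] at hc
        refine Fin.lastCases (fun h => absurd h (lt_irrefl _)) (fun i' _ => ?_) i'
        rw [Fin.snoc_castSucc]
        by_contra hne
        obtain ⟨h1, h2⟩ := hT.support i' c hne
        rw [Finset.mem_sdiff, mem_alphaSet] at h2
        rcases h2 with h2 | h2
        · rcases hρ.support c (by simp [hc]) with h | h
          · omega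
          · have := hQ _ h; omega
        · exact h2.2 hc
      · intro c hc i'
        rw [Fin.snoc_castSucc] at hc
        refine Fin.lastCases (fun h => absurd h (Fin.castSucc_lt_last i).not_gt) (fun i' h => ?_) i'
        rw [Fin.snoc_castSucc]
        exact hT.north i c hc i' (by simpa using h)
    · intro i
      refine Fin.lastCases ?_ (fun i => ?_) i
      · intro c hc c' hcc
        rw [Fin.snoc_last] at hc ⊢
        exact hρ.west c hc c' hcc
      · intro c hc c' hcc
        rw [Fin.snoc_castSucc] at hc ⊢
        exact hT.west i c hc c' hcc

theorem matches_snoc {n R d : ℕ} {e : ℕ → Option ABSymbol} (T : Fin R → Fin n → Option ABSymbol)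
    (ρ : Fin n → Option ABSymbol) :
    Matches d e (Fin.snoc (α := fun _ => Fin n → Option ABSymbol) T ρ) ↔
      RowMatches (R + d) (e R) ρ ∧ Matches d e T := by
  unfold Matches
  rw [Fin.forall_fin_succ']
  simp only [Fin.snoc_castSucc, Fin.snoc_last, Fin.val_last, Fin.val_castSucc]
  exact and_comm

theorem freeColumns_snoc {n R : ℕ} {Q : Finset ℕ} {T : Fin R → Fin n → Option ABSymbol}
    {ρ : Fin n → Option ABSymbol} (hρ : IsRow R Q ρ) (hQ : ∀ y ∈ Q, R < y) :
    freeColumns (R + 1) Q (Fin.snoc (α := fun _ => Fin n → Option ABSymbol) T ρ) =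
      freeColumns R (insert R Q \ alphaSet ρ) T := by
  ext c
  simp only [freeColumns, Finset.mem_filter, Finset.mem_univ, true_and, Finset.mem_sdiff,
    Finset.mem_insert, mem_alphaSet, Fin.forall_fin_succ', Fin.snoc_castSucc, Fin.snoc_last]
  have h1 : (c : ℕ) < R → ρ c ≠ some ABSymbol.alpha := by
    intro hc h
    rcases hρ.support c (by simp [h]) with h | h
    · omega
    · have := hQ _ h; omega
  rw [Nat.lt_succ_iff_lt_or_eq]
  tauto

theorem card_freeRows_snoc {n R : ℕ} (T : Fin R → Fin n → Option ABSymbol)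
    (ρ : Fin n → Option ABSymbol) :
    (freeRows (Fin.snoc (α := fun _ => Fin n → Option ABSymbol) T ρ)).card =
      (freeRows T).card + if ∀ c, ρ c ≠ some ABSymbol.beta then 1 else 0 := by
  classical
  simp only [freeRows, Finset.card_filter]
  rw [Fin.sum_univ_castSucc]
  simp only [Fin.snoc_castSucc, Fin.snoc_last]

open Classical in
theorem sum_isPartial {n d : ℕ} (hd : 1 ≤ d) (e : ℕ → Option ABSymbol) (a b : ℝ) {R : ℕ}
    (hR : R ≤ n) (Q : Finset ℕ) (hQ : ∀ y ∈ Q, R ≤ y ∧ y < n) :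
    ∑ T : Fin R → Fin n → Option ABSymbol, (if IsPartial R Q T ∧ Matches d e T then
      a ^ (freeColumns R Q T).card * b ^ (freeRows T).card else 0) = transfer d e a b R Q := by
  induction R generalizing Q with
  | zero =>
    rw [Fintype.sum_unique, if_pos]
    · have h1 : ∀ T, (freeColumns (n := n) 0 Q T).map Fin.valEmbedding = Q := by
        intro T
        ext y
        simp only [freeColumns, Finset.mem_map, Finset.mem_filter, Finset.mem_univ, true_and,
          Fin.valEmbedding_apply, Nat.not_lt_zero, false_or, IsEmpty.forall_iff, and_true]
        exact ⟨by rintro ⟨c, h, rfl⟩; exact h, fun h => ⟨⟨y, (hQ y h).2⟩, h, rfl⟩⟩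
      have h2 : ∀ T, (freeColumns (n := n) 0 Q T).card = Q.card := fun T => by
        rw [← Finset.card_map, h1]
      rw [h2]
      simp [freeRows, transfer]
    · exact ⟨⟨fun i => i.elim0, fun i => i.elim0, fun i => i.elim0, fun i => i.elim0⟩,
        fun i => i.elim0⟩
  | succ R ih =>
    have hQ' : ∀ y ∈ Q, R < y ∧ y < n := fun y hy => ⟨(hQ y hy).1, (hQ y hy).2⟩
    have hQ1 : ∀ y ∈ Q, R < y := fun y hy => (hQ' y hy).1
    rw [transfer_succ, ← sum_isRow_matches hd hR hQ',
      ← (Fin.snocEquiv fun _ : Fin (R + 1) => Fin n → Option ABSymbol).sum_comp,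
      Fintype.sum_prod_type, Finset.sum_filter]
    refine Finset.sum_congr rfl fun ρ _ => ?_
    have hs : ∀ T : Fin R → Fin n → Option ABSymbol,
        (Fin.snocEquiv fun _ : Fin (R + 1) => Fin n → Option ABSymbol) (ρ, T) =
          Fin.snoc (α := fun _ => Fin n → Option ABSymbol) T ρ := fun T => rfl
    simp only [hs]
    by_cases hρ : IsRow R Q ρ
    · rw [if_pos hρ, ← ih (by omega) (insert R Q \ alphaSet ρ) (by
        intro y hy
        rcases Finset.mem_insert.1 (Finset.mem_sdiff.1 hy).1 with rfl | hy
        exacts [⟨le_rfl, hR⟩, ⟨(hQ' y hy).1.le, (hQ' y hy).2⟩])]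
      by_cases hm : RowMatches (R + d) (e R) ρ
      · rw [if_pos hm, Finset.mul_sum]
        refine Finset.sum_congr rfl fun T _ => ?_
        rw [isPartial_snoc hQ1, matches_snoc, freeColumns_snoc hρ hQ1, card_freeRows_snoc]
        simp only [hρ, hm, true_and]
        split_ifs <;> ring
      · rw [if_neg hm]
        refine Finset.sum_eq_zero fun T _ => if_neg ?_
        rw [matches_snoc]
        exact fun h => hm h.2.1
    · rw [if_neg hρ]
      refine Finset.sum_eq_zero fun T _ => if_neg ?_
      rw [isPartial_snoc hQ1]
      exact fun h => hρ h.1.1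

/-! ### Tableaux as fillings with reversed columns -/

/-- Reversal of the order of the columns. -/
def revColumns {n : ℕ} (T : Fin n → Fin n → Option ABSymbol) : Fin n → Fin n → Option ABSymbol :=
  fun i c => T i c.rev

theorem revColumns_revColumns {n : ℕ} (T : Fin n → Fin n → Option ABSymbol) :
    revColumns (revColumns T) = T := by
  funext i c
  simp [revColumns]

theorem isPartial_revColumns_iff {n : ℕ} (T : Fin n → Fin n → Option ABSymbol) :
    IsPartial n ∅ (revColumns T) ↔ IsStaircaseTableau T := by
  have hrev : ∀ c : Fin n, (c.rev : ℕ) + c + 1 = n := fun c => by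
    rw [Fin.val_rev]; omega
  constructor
  · intro h
    have hT : ∀ i c, T i c = revColumns T i c.rev := fun i c => by simp [revColumns]
    refine ⟨fun i j hij => ?_, fun i j hij => ?_, fun i j hij i' hi => ?_, fun i j hij j' hj => ?_⟩
    · by_contra hne
      rw [hT] at hne
      have := (h.support _ _ hne).1
      have := hrev j
      omega
    · rw [hT]
      exact h.diagonal _ _ (by have := hrev j; omega)
    · rw [hT] at hij ⊢
      exact h.north _ _ hij _ hi
    · rw [hT] at hij ⊢
      exact h.west _ _ hij _ (Fin.rev_lt_rev.2 hj)
  · intro h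
    refine ⟨fun i c hc => ⟨?_, Or.inl c.2⟩, fun i c hc => ?_, fun i c hc i' hi => ?_,
      fun i c hc c' hcc => ?_⟩
    · by_contra hlt
      exact hc (h.outside _ _ (by have := hrev c; omega))
    · exact h.diagonal _ _ (by have := hrev c; omega)
    · exact h.north _ _ hc _ hi
    · exact h.west _ _ hc _ (Fin.rev_lt_rev.2 hcc)

/-- The weight of a tableau, divided by `α ^ n * β ^ n`, in terms of `a = α⁻¹` and `b = β⁻¹`. -/
noncomputable def scaledWeight {n : ℕ} (a b : ℝ) (S : StaircaseTableau n) : ℝ :=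
  a ^ (n - S.count ABSymbol.alpha) * b ^ (n - S.count ABSymbol.beta)

/-- A column has at most one `α`, so counting `α`s is counting the columns that have one. -/
theorem card_freeColumns_add_count {n : ℕ} (S : StaircaseTableau n) :
    (freeColumns n ∅ (revColumns S.1)).card + S.count ABSymbol.alpha = n := by
  classical
  have h1 : S.count ABSymbol.alpha =
      (Finset.univ.filter fun c : Fin n => ∃ i, S.1 i c = some ABSymbol.alpha).card := by
    rw [count]
    refine Finset.card_bij (fun q _ => q.2) ?_ ?_ ?_
    · exact fun q hq => Finset.mem_filter.2 ⟨Finset.mem_univ _, q.1, (Finset.mem_filter.1 hq).2⟩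
    · rintro ⟨i, c⟩ hq ⟨i', c'⟩ hq' heq
      simp only [Finset.mem_filter, Finset.mem_univ, true_and] at hq hq' heq
      subst heq
      rcases lt_trichotomy i i' with h | rfl | h
      · simp [S.2.north _ _ hq' _ h] at hq
      · rfl
      · simp [S.2.north _ _ hq _ h] at hq'
    · intro c hc
      obtain ⟨i, hi⟩ := (Finset.mem_filter.1 hc).2
      exact ⟨(i, c), Finset.mem_filter.2 ⟨Finset.mem_univ _, hi⟩, rfl⟩
  have h2 : (freeColumns n ∅ (revColumns S.1)).card =
      (Finset.univ.filter fun c : Fin n => ¬ ∃ i, S.1 i c = some ABSymbol.alpha).card := by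
    refine Finset.card_bij (fun c _ => c.rev) ?_ (fun c _ c' _ h => Fin.rev_injective h) ?_
    · intro c hc
      simpa [freeColumns, revColumns] using hc
    · intro c hc
      refine ⟨c.rev, ?_, Fin.rev_rev c⟩
      simpa [freeColumns, revColumns] using hc
  rw [h1, h2, add_comm, Finset.card_filter_add_card_filter_not, Finset.card_univ, Fintype.card_fin]

theorem card_freeRows_add_count {n : ℕ} (S : StaircaseTableau n) :
    (freeRows (revColumns S.1)).card + S.count ABSymbol.beta = n := by
  classical
  have h1 : S.count ABSymbol.beta =
      (Finset.univ.filter fun i : Fin n => ∃ c, S.1 i c = some ABSymbol.beta).card := by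
    rw [count]
    refine Finset.card_bij (fun q _ => q.1) ?_ ?_ ?_
    · exact fun q hq => Finset.mem_filter.2 ⟨Finset.mem_univ _, q.2, (Finset.mem_filter.1 hq).2⟩
    · rintro ⟨i, c⟩ hq ⟨i', c'⟩ hq' heq
      simp only [Finset.mem_filter, Finset.mem_univ, true_and] at hq hq' heq
      subst heq
      rcases lt_trichotomy c c' with h | rfl | h
      · simp [S.2.west _ _ hq' _ h] at hq
      · rfl
      · simp [S.2.west _ _ hq _ h] at hq'
    · intro i hi
      obtain ⟨c, hc⟩ := (Finset.mem_filter.1 hi).2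
      exact ⟨(i, c), Finset.mem_filter.2 ⟨Finset.mem_univ _, hc⟩, rfl⟩
  have h2 : (freeRows (revColumns S.1)).card =
      (Finset.univ.filter fun i : Fin n => ¬ ∃ c, S.1 i c = some ABSymbol.beta).card := by
    congr 1
    ext i
    rw [freeRows, Finset.mem_filter, Finset.mem_filter, not_exists]
    exact and_congr_right fun _ => ⟨fun h c => by simpa [revColumns] using h c.rev,
      fun h c => h c.rev⟩
  rw [h1, h2, add_comm, Finset.card_filter_add_card_filter_not, Finset.card_univ, Fintype.card_fin]

/-! ### Probabilities as ratios of scaled sums -/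

/-- The set of the tableaux that contain the symbols prescribed by `e`. -/
def matchSet (n d : ℕ) (e : ℕ → Option ABSymbol) : Set (StaircaseTableau n) :=
  {S | Matches d e (revColumns S.1)}

open Classical in
/-- The sum of the scaled weights of the tableaux in `E`. -/
noncomputable def scaledSum (n : ℕ) (a b : ℝ) (E : Set (StaircaseTableau n)) : ℝ :=
  ∑ S ∈ Finset.univ.filter (fun S : StaircaseTableau n => S ∈ E), scaledWeight a b S

theorem scaledSum_matchSet {n d : ℕ} (hd : 1 ≤ d) (e : ℕ → Option ABSymbol) (a b : ℝ) :
    scaledSum n a b (matchSet n d e) = transfer d e a b n ∅ := by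
  classical
  rw [← sum_isPartial hd e a b le_rfl ∅ (by simp), ← Finset.sum_filter, scaledSum]
  refine Finset.sum_bij (fun S _ => revColumns S.1) ?_ ?_ ?_ ?_
  · intro S hS
    exact Finset.mem_filter.2 ⟨Finset.mem_univ _, (isPartial_revColumns_iff _).2 S.2,
      (Finset.mem_filter.1 hS).2⟩
  · intro S _ S' _ h
    apply Subtype.ext
    rw [← revColumns_revColumns S.1, h, revColumns_revColumns]
  · intro T hT
    obtain ⟨-, h1, h2⟩ := Finset.mem_filter.1 hT
    rw [← revColumns_revColumns T] at h1
    refine ⟨⟨revColumns T, (isPartial_revColumns_iff _).1 h1⟩,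
      Finset.mem_filter.2 ⟨Finset.mem_univ _, ?_⟩, revColumns_revColumns T⟩
    change Matches d e (revColumns (revColumns T))
    rwa [revColumns_revColumns]
  · intro S _
    have h1 := card_freeColumns_add_count S
    have h2 := card_freeRows_add_count S
    rw [scaledWeight]
    congr <;> omega

theorem scaledSum_univ (n : ℕ) (a b : ℝ) : scaledSum n a b Set.univ = risingProd a b n := by
  have : (Set.univ : Set (StaircaseTableau n)) = matchSet n 1 fun _ => none := by
    refine (Set.eq_univ_of_forall fun S i x hx => ?_).symm
    simp at hx
  rw [this, scaledSum_matchSet le_rfl, transfer_eq_of_none (by simp) b (by simp)]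
  simp

theorem prob_inv_inv {n : ℕ} {a b : ℝ} (ha : 0 < a) (hb : 0 < b) (E : Set (StaircaseTableau n)) :
    prob n a⁻¹ b⁻¹ E = scaledSum n a b E / risingProd a b n := by
  classical
  have hw : ∀ S : StaircaseTableau n, wt a⁻¹ b⁻¹ S = scaledWeight a b S / (a ^ n * b ^ n) := by
    intro S
    have h1 := card_freeColumns_add_count S
    have h2 := card_freeRows_add_count S
    rw [wt, scaledWeight, inv_pow, inv_pow, eq_div_iff (by positivity)]
    have ea : a ^ n = a ^ (n - S.count ABSymbol.alpha) * a ^ S.count ABSymbol.alpha := by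
      rw [← pow_add]; congr 1; omega
    have eb : b ^ n = b ^ (n - S.count ABSymbol.beta) * b ^ S.count ABSymbol.beta := by
      rw [← pow_add]; congr 1; omega
    rw [ea, eb]
    field_simp
  have hZ : partitionFunction n a⁻¹ b⁻¹ = risingProd a b n / (a ^ n * b ^ n) := by
    rw [partitionFunction, ← scaledSum_univ, scaledSum, Finset.sum_div]
    simp [hw]
  have hZp := risingProd_pos (a := a) (b := b) (by positivity) n
  rw [prob, scaledSum, Finset.sum_div]
  refine Finset.sum_congr rfl fun S _ => ?_
  rw [hw, hZ, div_div_div_cancel_right₀ (by positivity)]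

theorem scaledWeight_nonneg {n : ℕ} {a b : ℝ} (ha : 0 ≤ a) (hb : 0 ≤ b) (S : StaircaseTableau n) :
    0 ≤ scaledWeight a b S := mul_nonneg (pow_nonneg ha _) (pow_nonneg hb _)

/-! ### Infinite weights as limits -/

theorem continuous_scaledSum (n : ℕ) (E : Set (StaircaseTableau n)) :
    Continuous fun q : ℝ × ℝ => scaledSum n q.1 q.2 E := by
  unfold scaledSum scaledWeight
  fun_prop

theorem continuous_risingProd (n : ℕ) : Continuous fun q : ℝ × ℝ => risingProd q.1 q.2 n := by
  unfold risingProd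
  fun_prop

theorem exists_tendsto_prob {n : ℕ} {a b : ℝ} (hab : 0 < a + b) {u v : ℝ → ℝ}
    (hu : Tendsto u atTop (𝓝 a)) (hv : Tendsto v atTop (𝓝 b))
    (huv : ∀ᶠ t in atTop, 0 < u t ∧ 0 < v t) (E : Set (StaircaseTableau n)) :
    ∃ p, Tendsto (fun t => prob n (u t)⁻¹ (v t)⁻¹ E) atTop (𝓝 p) := by
  have h : Tendsto (fun t => (u t, v t)) atTop (𝓝 (a, b)) := hu.prodMk_nhds hv
  refine ⟨scaledSum n a b E / risingProd a b n, Tendsto.congr' ?_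
    ((((continuous_scaledSum n E).tendsto (a, b)).comp h).div
      (((continuous_risingProd n).tendsto (a, b)).comp h) (risingProd_pos hab n).ne')⟩
  filter_upwards [huv] with t ht
  rw [prob_inv_inv ht.1 ht.2]
  rfl

/-- No tableau has `n` symbols of both kinds, so the scaled weights with `a = b = s` are all
divisible by `s`. -/
theorem one_le_missing {n : ℕ} (hn : 1 ≤ n) (S : StaircaseTableau n) :
    1 ≤ (n - S.count ABSymbol.alpha) + (n - S.count ABSymbol.beta) := by
  classical
  by_contra hlt
  -- At `a = b = 0` the partition function vanishes and all weights are nonnegative, while a tableau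
  -- with nothing missing would have weight `0 ^ 0 * 0 ^ 0 = 1`.
  have h0 : scaledSum n 0 0 Set.univ = 0 := by
    obtain ⟨m, rfl⟩ := Nat.exists_eq_add_of_le' hn
    rw [scaledSum_univ, risingProd_succ']
    simp
  have hS := (Finset.sum_eq_zero_iff_of_nonneg fun S _ =>
    scaledWeight_nonneg le_rfl le_rfl S).1 h0 S (by simp)
  rw [scaledWeight, show n - S.count ABSymbol.alpha = 0 by omega,
    show n - S.count ABSymbol.beta = 0 by omega] at hS
  simp at hS

/-- Numerator and denominator both vanish at `s = 0`; after cancelling one factor `s`, the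
denominator is positive there. -/
theorem exists_tendsto_prob_diagonal {n : ℕ} (hn : 1 ≤ n) (E : Set (StaircaseTableau n)) :
    ∃ p, Tendsto (fun t : ℝ => prob n (t⁻¹)⁻¹ (t⁻¹)⁻¹ E) atTop (𝓝 p) := by
  classical
  set g : ℝ → ℝ := fun s => ∑ S ∈ Finset.univ.filter (fun S : StaircaseTableau n => S ∈ E),
    s ^ ((n - S.count ABSymbol.alpha) + (n - S.count ABSymbol.beta) - 1) with hg
  have hgc : Continuous g := by rw [hg]; fun_prop
  have hzc : Continuous fun s : ℝ => 2 * risingProd s (s + 1) (n - 1) := by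
    unfold risingProd
    fun_prop
  have hz0 : 2 * risingProd 0 (0 + 1) (n - 1) ≠ 0 :=
    mul_ne_zero two_ne_zero (risingProd_pos (by norm_num) _).ne'
  refine ⟨g 0 / (2 * risingProd 0 (0 + 1) (n - 1)), Tendsto.congr' ?_
    (((hgc.tendsto 0).div (hzc.tendsto 0) hz0).comp tendsto_inv_atTop_zero)⟩
  filter_upwards [eventually_gt_atTop 0] with t ht
  have hs : 0 < t⁻¹ := inv_pos.2 ht
  rw [prob_inv_inv hs hs]
  simp only [Function.comp_apply]
  set s := t⁻¹
  have h1 : scaledSum n s s E = s * g s := by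
    rw [scaledSum, hg, Finset.mul_sum]
    refine Finset.sum_congr rfl fun S _ => ?_
    rw [scaledWeight, ← pow_add, ← pow_succ', Nat.sub_add_cancel (one_le_missing hn S)]
  have h2 : risingProd s s n = s * (2 * risingProd s (s + 1) (n - 1)) := by
    obtain ⟨m, rfl⟩ := Nat.exists_eq_add_of_le' hn
    rw [risingProd_succ', Nat.add_sub_cancel]
    ring
  rw [h1, h2, mul_div_mul_left _ _ hs.ne']
  rfl

/-- All probabilities with `a, b ≥ 0` are limits of probabilities with positive parameters, along
the same path for all events. -/
theorem exists_path {n : ℕ} (hn : 1 ≤ n) {a b : ℝ} (ha : 0 ≤ a) (hb : 0 ≤ b) :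
    ∃ u v : ℝ → ℝ, (∀ᶠ t in atTop, 0 < u t ∧ 0 < v t) ∧ Tendsto u atTop (𝓝 a) ∧
      Tendsto v atTop (𝓝 b) ∧ ∀ E : Set (StaircaseTableau n), ∃ p,
        Tendsto (fun t => prob n (u t)⁻¹ (v t)⁻¹ E) atTop (𝓝 p) ∧ IsProb n a b E p := by
  have hinv : ∀ᶠ t : ℝ in atTop, 0 < t⁻¹ := by
    filter_upwards [eventually_gt_atTop 0] with t ht using inv_pos.2 ht
  rcases ha.eq_or_lt with rfl | ha <;> rcases hb.eq_or_lt with rfl | hb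
  · refine ⟨fun t => t⁻¹, fun t => t⁻¹, hinv.mono fun t h => ⟨h, h⟩, tendsto_inv_atTop_zero,
      tendsto_inv_atTop_zero, fun E => ?_⟩
    obtain ⟨p, hp⟩ := exists_tendsto_prob_diagonal hn E
    exact ⟨p, hp, Or.inr (Or.inr (Or.inr ⟨rfl, rfl, by simpa only [inv_inv] using hp⟩))⟩
  · have h : ∀ᶠ t : ℝ in atTop, 0 < t⁻¹ ∧ 0 < b := hinv.mono fun t h => ⟨h, hb⟩
    refine ⟨fun t => t⁻¹, fun _ => b, h, tendsto_inv_atTop_zero, tendsto_const_nhds, fun E => ?_⟩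
    obtain ⟨p, hp⟩ := exists_tendsto_prob (by simpa using hb) tendsto_inv_atTop_zero
      tendsto_const_nhds h E
    exact ⟨p, hp, Or.inr (Or.inl ⟨rfl, hb, by simpa only [inv_inv] using hp⟩)⟩
  · have h : ∀ᶠ t : ℝ in atTop, 0 < a ∧ 0 < t⁻¹ := hinv.mono fun t h => ⟨ha, h⟩
    refine ⟨fun _ => a, fun t => t⁻¹, h, tendsto_const_nhds, tendsto_inv_atTop_zero, fun E => ?_⟩
    obtain ⟨p, hp⟩ := exists_tendsto_prob (by simpa using ha) tendsto_const_nhds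
      tendsto_inv_atTop_zero h E
    exact ⟨p, hp, Or.inr (Or.inr (Or.inl ⟨ha, rfl, by simpa only [inv_inv] using hp⟩))⟩
  · exact ⟨fun _ => a, fun _ => b, Eventually.of_forall fun _ => ⟨ha, hb⟩, tendsto_const_nhds,
      tendsto_const_nhds, fun E => ⟨_, tendsto_const_nhds, Or.inl ⟨ha, hb, rfl⟩⟩⟩

/-! ### Events in original coordinates and bounds for positive `a`, `b` -/

theorem matchSet_eq_iInter {n d : ℕ} {ι : Sort*} {e : ℕ → Option ABSymbol} {x : ι → ABSymbol}
    {j : ι → ℕ} (hj : ∀ l, 1 ≤ j l ∧ j l + (d + 1) ≤ n + 1) (he : ∀ l, e (n - d - j l) = some (x l))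
    (he' : ∀ i, e i ≠ none → ∃ l, n - d - j l = i) :
    matchSet n d e = ⋂ l, symbolAt n (d + 1) (x l) (j l) := by
  ext S
  rw [Set.mem_iInter]
  constructor
  · intro h l
    have hl := hj l
    obtain ⟨c, hc, hcx⟩ := h ⟨n - d - j l, by omega⟩ (x l) (he l)
    simp only at hc
    have hrev : (c.rev : ℕ) + c + 1 = n := by rw [Fin.val_rev]; omega
    exact ⟨_, c.rev, by omega, by simp only; omega, hcx⟩
  · intro h i y hy
    obtain ⟨l, hl⟩ := he' i (by simp [hy])
    have hl' := hj l
    obtain ⟨i', c, hc, hi, hS⟩ := h l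
    obtain rfl : i' = i := Fin.ext (by omega)
    have hrev : (c.rev : ℕ) + c + 1 = n := by rw [Fin.val_rev]; omega
    refine ⟨c.rev, by omega, ?_⟩
    rw [← hl, he l] at hy
    obtain rfl := Option.some.inj hy
    simpa [revColumns] using hS

theorem prob_matchSet {n d : ℕ} (hd : 1 ≤ d) (e : ℕ → Option ABSymbol) {a b : ℝ} (ha : 0 < a)
    (hb : 0 < b) :
    prob n a⁻¹ b⁻¹ (matchSet n d e) = transfer d e a b n ∅ / risingProd a b n := by
  rw [prob_inv_inv ha hb, scaledSum_matchSet hd]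

/-- As this is exact, the product of marginals and the explicit product coincide for positive
parameters, and one error bound serves for both. -/
theorem prob_symbolAt {n d : ℕ} (hd : 1 ≤ d) {a b : ℝ} (ha : 0 < a) (hb : 0 < b) (x : ABSymbol)
    {j : ℕ} (hj : 1 ≤ j ∧ j + (d + 1) ≤ n + 1) :
    prob n a⁻¹ b⁻¹ (symbolAt n (d + 1) x j) = symbolProb d a (b + n) (n - d - j) (some x) := by
  have h := matchSet_eq_iInter (n := n) (d := d) (ι := Unit) (x := fun _ => x) (j := fun _ => j)
    (e := fun i => if i = n - d - j then some x else none) (fun _ => hj) (by simp) (by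
      intro i hi
      refine ⟨(), ?_⟩
      by_contra hne
      exact hi (if_neg fun h => hne h.symm))
  rw [Set.iInter_const] at h
  rw [← h, prob_matchSet hd _ ha hb, transfer_single hd ha hb (i := n - d - j) (x := x) (by simp)
    (by omega) fun l _ hl => by simp [hl], mul_div_cancel_right₀]
  exact (risingProd_pos (by positivity) n).ne'

/-- The bounds of the theorem for positive `a` and `b`. -/
theorem exists_bound {d : ℕ} (hd : 1 ≤ d) (r : ℕ) : ∃ C : ℝ, 0 ≤ C ∧
    ∀ (n : ℕ) (x : Fin r → ABSymbol) (j : Fin r → ℕ), 1 ≤ n → StrictMono j →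
      (∀ l, 1 ≤ j l ∧ j l + (d + 1) ≤ n + 1) → ∀ a b : ℝ, 0 < a → 0 < b →
      prob n a⁻¹ b⁻¹ (⋂ l, symbolAt n (d + 1) (x l) (j l)) ∈ Set.Icc 0 1 ∧
      prob n a⁻¹ b⁻¹ (⋂ l, symbolAt n (d + 1) (x l) (j l)) ≤ C / (n + a + b) ^ r ∧
      ((∀ l l' : Fin r, (l' : ℕ) = l + 1 → j l + (d + 1) ≤ j l') →
        |prob n a⁻¹ b⁻¹ (⋂ l, symbolAt n (d + 1) (x l) (j l)) -
          ∏ l, symbolProb d a (b + n) (n - d - j l) (some (x l))| ≤ C / (n + a + b) ^ (r + 1)) := by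
  classical
  obtain ⟨C₁, hC₁, h₁⟩ := transfer_mul_pow_le d r
  obtain ⟨C₂, hC₂, h₂⟩ := abs_transfer_sub_mainTerm_le hd r
  refine ⟨C₁ + C₂, by positivity, fun n x j hn hj hjn a b ha hb => ?_⟩
  set I : Fin r → ℕ := fun l => n - d - j l with hI
  have hIj : ∀ l, I l + d + j l = n := fun l => by
    have := hjn l
    simp only [hI]
    omega
  have hinj : Function.Injective I := fun l l' h => hj.injective (by
    have h1 := hIj l
    have h2 := hIj l'
    rw [h] at h1
    omega)
  set e : ℕ → Option ABSymbol := fun i => if h : ∃ l, I l = i then some (x h.choose) else none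
    with he
  have heI : ∀ l, e (I l) = some (x l) := by
    intro l
    have h : ∃ l', I l' = I l := ⟨l, rfl⟩
    simp only [he]
    rw [dif_pos h, hinj h.choose_spec]
  have heI' : ∀ i, e i ≠ none → ∃ l, I l = i := by
    intro i hi
    by_contra h
    exact hi (dif_neg h)
  have hfilter : (Finset.range n).filter (fun i => e i ≠ none) = Finset.univ.image I := by
    ext i
    simp only [Finset.mem_filter, Finset.mem_range, Finset.mem_image, Finset.mem_univ, true_and]
    constructor
    · exact fun h => heI' i h.2
    · rintro ⟨l, rfl⟩
      have := hIj l
      have := hjn l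
      exact ⟨by omega, by simp [heI l]⟩
  have hcount : eventCount e n = r := by
    rw [eventCount, hfilter, Finset.card_image_of_injective _ hinj, Finset.card_univ,
      Fintype.card_fin]
  have hmain : mainTerm d e a (b + n) n =
      ∏ l, symbolProb d a (b + n) (n - d - j l) (some (x l)) := by
    rw [mainTerm, ← Finset.prod_filter_mul_prod_filter_not _ (fun i => e i ≠ none), hfilter,
      Finset.prod_image fun _ _ _ _ h => hinj h, Finset.prod_eq_one (s := Finset.filter _ _), mul_one]
    · exact Finset.prod_congr rfl fun l _ => by rw [heI]
    · intro i hi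
      have := (Finset.mem_filter.1 hi).2
      rw [not_not.1 this]
      rfl
  rw [← matchSet_eq_iInter hjn heI heI', prob_matchSet hd e ha hb, ← hmain]
  have hZ := risingProd_pos (a := a) (b := b) (by positivity) n
  have hT := transfer_nonneg (d := d) (e := e) ha.le hb.le n ∅
  have hn0 : (0 : ℝ) < n := by exact_mod_cast hn
  have hN : 0 < n + a + b := by positivity
  refine ⟨⟨by positivity, (div_le_one hZ).2 (by
    simpa using transfer_le_risingProd (d := d) (e := e) ha.le hb.le (R := n) (Q := ∅) (by simp))⟩,
    ?_, fun hsep => ?_⟩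
  · have h := h₁ e a b n ∅ ha.le hb.le (by simp) hcount
    simp only [Finset.card_empty, Nat.cast_zero, add_zero] at h
    rw [div_le_div_iff₀ hZ (by positivity)]
    calc _ ≤ transfer d e a b n ∅ * (n + a + b + 1) ^ r :=
          mul_le_mul_of_nonneg_left (pow_le_pow_left₀ hN.le (by linarith) _) hT
      _ ≤ C₁ * risingProd a b n := h
      _ ≤ _ := by gcongr; linarith
  · have hsep' : ∀ l l', l < l' → j l + (d + 1) ≤ j l' := by
      intro l l' hl
      have hlt : (l : ℕ) + 1 < r := by have := l'.2; have : (l : ℕ) < l' := hl; omega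
      exact (hsep l ⟨l + 1, hlt⟩ rfl).trans (hj.monotone (show (⟨l + 1, hlt⟩ : Fin r) ≤ l' from hl))
    have h := h₂ e a b n ha hb (fun i _ hi => by
        obtain ⟨l, rfl⟩ := heI' i hi
        have := hIj l
        have := hjn l
        omega) (fun i i' hii _ hi hi' => by
        obtain ⟨l, rfl⟩ := heI' i hi
        obtain ⟨l', rfl⟩ := heI' i' hi'
        have h1 := hIj l
        have h2 := hIj l'
        rcases lt_trichotomy l' l with h | rfl | h
        · have := hsep' _ _ h
          omega
        · omega
        · have := hj h
          omega) hcount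
    have e1 : transfer d e a b n ∅ / risingProd a b n - mainTerm d e a (b + n) n =
        (transfer d e a b n ∅ - mainTerm d e a (b + n) n * risingProd a b n) / risingProd a b n := by
      field_simp
    rw [e1, abs_div, abs_of_pos hZ, div_le_div_iff₀ hZ (by positivity)]
    calc _ ≤ _ * (n + a + b + 1) ^ (r + 1) :=
          mul_le_mul_of_nonneg_left (pow_le_pow_left₀ hN.le (by linarith) _) (abs_nonneg _)
      _ ≤ C₂ * risingProd a b n := h
      _ ≤ _ := by gcongr; linarith

/-! ### Zero weights and passage to the limit -/

theorem count_pos {n : ℕ} {S : StaircaseTableau n} {x : ABSymbol} {i c : Fin n}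
    (h : S.1 i c = some x) : 0 < S.count x :=
  Finset.card_pos.2 ⟨(i, c), Finset.mem_filter.2 ⟨Finset.mem_univ _, h⟩⟩

/-- The diagonal box below an `α` cannot be `α`, and the diagonal box to the right of a `β` cannot
be `β`. So a symbol off the first diagonal forces the other symbol to occur, and a zero weight of
either kind kills the tableau. -/
theorem count_pos_of_not_diagonal {n : ℕ} {S : StaircaseTableau n} {x : ABSymbol} {i c : Fin n}
    (h : S.1 i c = some x) (hic : (i : ℕ) + c + 1 < n) (y : ABSymbol) : 0 < S.count y := by
  have hx := count_pos h
  rcases x with _ | _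
  · have h1 := S.2.diagonal ⟨n - 1 - c, by omega⟩ c (by simp only; omega)
    rcases h2 : S.1 ⟨n - 1 - c, by omega⟩ c with _ | _ | _
    · exact absurd h2 h1
    · have := S.2.north _ _ h2 i (by rw [Fin.lt_def]; simp only; omega)
      simp [h] at this
    · rcases y with _ | _
      exacts [hx, count_pos h2]
  · have h1 := S.2.diagonal i ⟨n - 1 - i, by omega⟩ (by simp only; omega)
    rcases h2 : S.1 i ⟨n - 1 - i, by omega⟩ with _ | _ | _
    · exact absurd h2 h1
    · rcases y with _ | _
      exacts [count_pos h2, hx]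
    · have := S.2.west _ _ h2 c (by rw [Fin.lt_def]; simp only; omega)
      simp [h] at this

theorem prob_eq_zero_of_wt {n : ℕ} {α β : ℝ} {E : Set (StaircaseTableau n)}
    (h : ∀ S ∈ E, wt α β S = 0) : prob n α β E = 0 := by
  classical
  exact Finset.sum_eq_zero fun S hS => by rw [h S (Finset.mem_filter.1 hS).2, zero_div]

theorem tendsto_symbolProb {d : ℕ} {a B : ℝ} {u w : ℝ → ℝ} (hu : Tendsto u atTop (𝓝 a))
    (hw : Tendsto w atTop (𝓝 B)) (h : 0 < B + a - d - 1) (i : ℕ) (x : ABSymbol) :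
    Tendsto (fun t => symbolProb d (u t) (w t) i (some x)) atTop
      (𝓝 (symbolProb d a B i (some x))) := by
  simp only [symbolProb]
  refine Tendsto.div ?_ ?_ (mul_pos (by linarith) h).ne'
  · rcases x with _ | _
    · exact (hw.sub_const _).sub_const _
    · exact hu.add_const _
  · exact ((hw.add hu).sub_const _).mul (((hw.add hu).sub_const _).sub_const _)

end StaircaseTableau

theorem theorem5p0 (k r₁ r₂ : ℕ) (hk : 2 ≤ k) :
    ∃ C : ℝ, ∀ (n : ℕ) (x : Fin (r₁ + r₂) → ABSymbol) (j : Fin (r₁ + r₂) → ℕ), 1 ≤ n →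
      (Finset.univ.filter fun l => x l = ABSymbol.alpha).card = r₁ →
      (Finset.univ.filter fun l => x l = ABSymbol.beta).card = r₂ →
      StrictMono j → (∀ l, 1 ≤ j l ∧ j l + k ≤ n + 1) →
      -- `a = α⁻¹` and `b = β⁻¹` in `[0, ∞)`, with `0` for an infinite weight
      (∀ a b : ℝ, 0 ≤ a → 0 ≤ b →
        ∃ (p : ℝ) (q : Fin (r₁ + r₂) → ℝ),
          StaircaseTableau.IsProb n a b
            (⋂ l, StaircaseTableau.symbolAt n k (x l) (j l)) p ∧
          (∀ l, StaircaseTableau.IsProb n a b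
            (StaircaseTableau.symbolAt n k (x l) (j l)) (q l)) ∧
          ((∀ l l' : Fin (r₁ + r₂), (l' : ℕ) = l + 1 → j l + k ≤ j l') →
            |p - (∏ l with x l = ABSymbol.alpha, q l) * ∏ l with x l = ABSymbol.beta, q l|
                ≤ C / (n + a + b) ^ (r₁ + r₂ + 1) ∧
            |p - (∏ l with x l = ABSymbol.alpha,
                    ((j l : ℝ) + b - 1) / ((n + a + b - k + 1) * (n + a + b - k))) *
                  ∏ l with x l = ABSymbol.beta,
                    ((n : ℝ) - j l - k + a + 1) / ((n + a + b - k + 1) * (n + a + b - k))|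
                ≤ C / (n + a + b) ^ (r₁ + r₂ + 1)) ∧
          ((¬ ∀ l l' : Fin (r₁ + r₂), (l' : ℕ) = l + 1 → j l + k ≤ j l') →
            p ≤ C / (n + a + b) ^ (r₁ + r₂))) ∧
      -- a weight `0` (that is, `a = ∞` or `b = ∞`): all terms and error bounds above are `0`
      (0 < r₁ + r₂ → ∀ c : ℝ, 0 < c →
        StaircaseTableau.prob n 0 c
          (⋂ l, StaircaseTableau.symbolAt n k (x l) (j l)) = 0 ∧
        StaircaseTableau.prob n c 0
          (⋂ l, StaircaseTableau.symbolAt n k (x l) (j l)) = 0) := by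
  obtain ⟨d, rfl⟩ : ∃ d, k = d + 1 := ⟨k - 1, by omega⟩
  have hd : 1 ≤ d := by omega
  generalize hr : r₁ + r₂ = r
  obtain ⟨C, hC, hbound⟩ := StaircaseTableau.exists_bound hd r
  -- The additional constant serves only the degenerate case `n + a + b = k`, where the explicit
  -- formula need not be the limit of the marginals.
  refine ⟨C + (d + 1 : ℕ) ^ (r + 1), fun n x j hn _ _ hj hjn => ⟨fun a b ha hb => ?_, ?_⟩⟩
  · obtain ⟨u, v, hpos, hu, hv, hlim⟩ := StaircaseTableau.exists_path hn ha hb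
    obtain ⟨p, hp, hpP⟩ := hlim (⋂ l, StaircaseTableau.symbolAt n (d + 1) (x l) (j l))
    choose q hq hqP using fun l => hlim (StaircaseTableau.symbolAt n (d + 1) (x l) (j l))
    have hn0 : (1 : ℝ) ≤ n := by exact_mod_cast hn
    have hN : 0 < n + a + b := by linarith
    have hC' : C ≤ C + ((d + 1 : ℕ) : ℝ) ^ (r + 1) := le_add_of_nonneg_right (by positivity)
    have hB : ∀ m : ℕ, Tendsto (fun t => C / (n + u t + v t) ^ m) atTop
        (𝓝 (C / (n + a + b) ^ m)) := fun m =>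
      tendsto_const_nhds.div (((hu.const_add _).add hv).pow m) (by positivity)
    have hmono : ∀ m : ℕ, C / (n + a + b) ^ m ≤
        (C + ((d + 1 : ℕ) : ℝ) ^ (r + 1)) / (n + a + b) ^ m := fun m => by gcongr
    refine ⟨p, q, hpP, hqP, fun hsep => ?_, fun _ => ?_⟩
    · have hsplit : ∀ f : Fin r → ℝ, (∏ l with x l = ABSymbol.alpha, f l) *
          ∏ l with x l = ABSymbol.beta, f l = ∏ l, f l := by
        intro f
        rw [← Finset.prod_filter_mul_prod_filter_not Finset.univ (fun l => x l = ABSymbol.alpha)]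
        congr 2
        ext l
        cases h : x l <;> simp [h]
      set f : Fin r → ℝ := fun l =>
        StaircaseTableau.symbolProb d a (b + n) (n - d - j l) (some (x l)) with hf
      have hformula : (∏ l with x l = ABSymbol.alpha,
            ((j l : ℝ) + b - 1) / ((n + a + b - (d + 1 : ℕ) + 1) * (n + a + b - (d + 1 : ℕ)))) *
          ∏ l with x l = ABSymbol.beta, ((n : ℝ) - j l - (d + 1 : ℕ) + a + 1) /
            ((n + a + b - (d + 1 : ℕ) + 1) * (n + a + b - (d + 1 : ℕ))) = ∏ l, f l := by
        rw [← hsplit]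
        have hcast : ∀ l, ((n - d - j l : ℕ) : ℝ) = n - d - j l := fun l => by
          have := hjn l
          rw [Nat.cast_sub (by omega), Nat.cast_sub (by omega)]
        congr 1 <;> refine Finset.prod_congr rfl fun l hl => ?_ <;>
          rw [hf] <;> simp only [(Finset.mem_filter.1 hl).2, StaircaseTableau.symbolProb,
            StaircaseTableau.symbolNumerator, hcast] <;> push_cast <;> congr 1 <;> ring
      rw [hsplit, hformula]
      have hE : |p - ∏ l, q l| ≤ C / (n + a + b) ^ (r + 1) := by
        refine le_of_tendsto_of_tendsto (hp.sub (tendsto_finsetProd _ fun l _ => hq l)).abs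
          (hB (r + 1)) ?_
        filter_upwards [hpos] with t ht
        have h := (hbound n x j hn hj hjn (u t) (v t) ht.1 ht.2).2.2 hsep
        rwa [← Finset.prod_congr rfl fun l _ =>
          StaircaseTableau.prob_symbolAt hd ht.1 ht.2 (x l) (hjn l)] at h
      refine ⟨hE.trans (hmono _), ?_⟩
      -- A limiting marginal can differ from the formula only where the denominator vanishes. There
      -- division by zero makes the product `0`, and `p ≤ 1` is enough because `n + a + b = d + 1`.
      by_cases hdeg : ∀ l, q l = f l
      · rw [Finset.prod_congr rfl fun l _ => hdeg l] at hE
        exact hE.trans (hmono _)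
      · obtain ⟨l₀, hl₀⟩ := not_forall.1 hdeg
        have hnd : (d + 1 : ℝ) ≤ n := by
          have := hjn l₀
          exact_mod_cast (show d + 1 ≤ n by omega)
        have hzero : b + n + a - d - 1 = 0 := by
          by_contra hne
          have hlt : 0 < b + n + a - d - 1 := lt_of_le_of_ne (by linarith) (Ne.symm hne)
          refine hl₀ (tendsto_nhds_unique (hq l₀) (Tendsto.congr' ?_
            (StaircaseTableau.tendsto_symbolProb hu (hv.add_const (n : ℝ)) hlt _ _)))
          filter_upwards [hpos] with t ht
          exact (StaircaseTableau.prob_symbolAt hd ht.1 ht.2 (x l₀) (hjn l₀)).symm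
        have hfz : ∏ l, f l = 0 := Finset.prod_eq_zero (Finset.mem_univ l₀) (by
          rw [hf]
          simp only [StaircaseTableau.symbolProb, hzero, mul_zero, div_zero])
        have hp01 : p ∈ Set.Icc (0 : ℝ) 1 := isClosed_Icc.mem_of_tendsto hp (by
          filter_upwards [hpos] with t ht
          exact (hbound n x j hn hj hjn (u t) (v t) ht.1 ht.2).1)
        rw [hfz, sub_zero, abs_of_nonneg hp01.1]
        refine hp01.2.trans ((one_le_div (by positivity)).2 ?_)
        have : (n : ℝ) + a + b = (d + 1 : ℕ) := by push_cast; linarith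
        rw [this]
        linarith
    · refine (le_of_tendsto_of_tendsto hp (hB r) ?_).trans (hmono r)
      filter_upwards [hpos] with t ht
      exact (hbound n x j hn hj hjn (u t) (v t) ht.1 ht.2).2.1
  · intro hr0 c _
    have hS : ∀ S ∈ ⋂ l, StaircaseTableau.symbolAt n (d + 1) (x l) (j l), ∀ y, 0 < S.count y := by
      intro S hS
      obtain ⟨i, c, hc, hi, hic⟩ := Set.mem_iInter.1 hS ⟨0, hr0⟩
      exact StaircaseTableau.count_pos_of_not_diagonal hic (by omega)
    constructor <;> refine StaircaseTableau.prob_eq_zero_of_wt fun S h => ?_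
    · rw [StaircaseTableau.wt, zero_pow (hS S h _).ne', zero_mul]
    · rw [StaircaseTableau.wt, zero_pow (hS S h _).ne', mul_zero]
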